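/- **Network.** Consider a time-slotted network with a finite set $\mathcal N$ of $N$ nodes, a set $\mathcal L$ of directed links between nodes, and a finite set $\mathcal F$ of $K$ flows; flow $c$ has source node $b(c)$ and destination node $d(c)$. In each slot $t$ integer rates $\mu^c_{mn}(t)\in\{0,1\}$ are assigned to links $(m,n)\in\mathcal L$ and an integer admitted rate $0\le\mu^c_{s(c)b(c)}(t)\le\mu_M$ ($\mu_M\ge 1$) to the virtual link from the transport layer $s(c)$ to $b(c)$. Each node takes part in at most one transmission per slot, and $\mu^c_{mb(c)}(t)=0$ for all $m\in\mathcal N$. Let $U^c_n(t)\in\mathbb N$ be the backlog of flow $c$ at node $n$, with $U_n^c(0)=0$, $U^c_{d(c)}(t)=0$, and, for $n\neq d(c)$, $U_n^c(t+1)\le[U_n^c(t)-\sum_i\mu_{ni}^c(t)]^++\sum_j\mu_{jn}^c(t)$, the last sum including the admitted rate if $n=b(c)$. The capacity region $\Lambda$ is the set of rate vectors $(z_c)$ for which some (possibly randomized) scheduling algorithm obeying these constraints, in which nodes forward only packets that they have and no packets are discarded, with packets entering at mean long-run rates $z_c$, keeps all node backlogs stable: $\limsup_t\frac1t\sum_{\tau<t}\mathbb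 E\,U_n^c(\tau)<\infty$. Given minimum rates $a_c\ge 0$ and $\epsilon>0$, let $(r^*_{\epsilon,c})$ maximize $\sum_c r_c$ subject to $(r_c+\epsilon)_c\in\Lambda$ and $r_c\ge a_c$ for all $c$, and assume that $r^*_{\epsilon,c}\ge a_c+\epsilon'$ for all $c$, where $\epsilon'>0$. **Algorithm ALG** (parameters $q_M$, $V>0$, delay thresholds $\rho_c$). There are virtual queues with $U_{s(c)}(0)=X_c(0)=Z_c(0)=0$ and $$U_{s(c)}(t+1)=[U_{s(c)}(t)-\mu^c_{s(c)b(c)}(t)]^++R_c(t),\quad Z_c(t+1)=[Z_c(t)-R_c(t)]^++a_c,\quad X_c(t+1)=[X_c(t)-\rho_cR_c(t)]^++\sum_{n\in\mathcal N}U_n^c(t).$$ The virtual input rate $R_c(t)\in[0,\mu_M]$ minimizes $R_c(t)\big(\tfrac{q_M-\mu_M}{q_M}U_{s(c)}(t)-\rho_cX_c(t)-Z_c(t)-V\big)$. The schedule is max-weight with weights $w^c_{mn}=\tfrac{U_{s(c)}}{q_M}(U^c_m-U^c_n)$ on links $(m,n)\in\mathcal L$ with $n\ne b(c)$, $w^c_{s(c)b(c)}=\tfrac{U_{s(c)}}{q_M}(q_M-\mu_M-U^c_{b(c)})$,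 and $w^c_{mn}=0$ otherwise: on each pair $(m,n)$ only a flow $c^*_{mn}$ of maximal weight may be served, $\sum_{m,n}\mu^{c^*_{mn}}_{mn}[\max_cw^c_{mn}]^+$ is maximized under the network constraints, and pairs with $[\max_cw^c_{mn}]^+=0$ stay idle. Ties are broken arbitrarily. **Theorem.** Suppose $$q_M>\frac{2N-1+\mu_M^2}{2\epsilon}+\mu_M\quad\text{and}\quad\rho_c>\frac{Nq_M}{r^*_{\epsilon,c}}\ \text{ for every flow }c .$$ Then, under ALG, $$\liminf_{t\to\infty}\frac1t\sum_{\tau=0}^{t-1}\sum_c\mathbb E\,R_c(\tau)\ \ge\ \sum_cr^*_{\epsilon,c}-\frac BV,$$ with $B=\frac12NKq_M\mu_M+K\frac{q_M-\mu_M}{q_M}\mu_M^2+\frac12\mu_M^2\sum_c\rho_c^2+\frac12KN^2q_M^2+\frac12K\mu_M^2+\frac12K\sum_ca_c^2$, and the same lower bound holds with the admitted rates $\mu^c_{s(c)b(c)}(\tau)$ in place of $R_c(\tau)$. Moreover $$\limsup_{t\to\infty}\frac1t\sum_{\tau=0}^{t-1}\sum_c\mathbb E\{U_{s(c)}(\tau)+X_c(\tau)+Z_c(\tau)\}\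 \le\ \frac{B+VB_R}{\delta}$$ for every real $B_R\ge\limsup_t\frac1t\sum_{\tau<t}\sum_c\mathbb E\,R_c(\tau)$ (a quantity that is at most $K\mu_M$), where $\delta=\min\{\epsilon_1,\epsilon'\}$ and $\epsilon_1>0$ is any number with $\epsilon_1\le\rho_cr^*_{\epsilon,c}-Nq_M$ for all $c$ and $\epsilon_1\le\big(\epsilon(q_M-\mu_M)-\frac{2N-1+\mu_M^2}2\big)/q_M$. Finally, for every flow $c$, almost surely $\limsup_t\frac1t\sum_{\tau<t}\big(\sum_nU_n^c(\tau)-\rho_c\,\mu^c_{s(c)b(c)}(\tau)\big)\le0$, i.e. by Little's law the average end-to-end delay of flow $c$ is at most $\rho_c$; and there is a constant $C$ depending only on the network and $\mu_M$ such that, for all $0<\epsilon\le1$ and all positive values of $r^*_{\epsilon,c}$, the parameters $q_M,\rho_c$ can be chosen to satisfy the two conditions above with $\rho_c\le C/(\epsilon\,r^*_{\epsilon,c})$, so that the delay bound is of order $1/\epsilon$. -/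

import Mathlib

open MeasureTheory Filter Topology

noncomputable section

namespace MultiHop

/-! ### The network -/

/-- A multi-hop network: directed links between nodes, and flows, each with a source node `b(c)`
and a destination node `d(c)`. -/
structure Network (Node Flow : Type*) where
  links : Set (Node × Node)
  src : Flow → Node
  dst : Flow → Node

/-- The pairs `(m, n)` over which rates are assigned: `Sum.inl (m, n)` is a pair of nodes and
`Sum.inr c` is the virtual link `(s(c), b(c))` from the transport layer of flow `c` to its source
node. -/
abbrev Pair (Node Flow : Type*) := (Node × Node) ⊕ Flow

/-- A rate assignment `μ_{mn}^c` (in packets per slot) for one time slot. -/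
abbrev Rates (Node Flow : Type*) := Pair Node Flow → Flow → ℕ

variable {Node Flow : Type*} [Fintype Node] [Fintype Flow]

/-- Scheduled departure rate of flow `c` from node `n`. -/
def outRate (μ : Rates Node Flow) (n : Node) (c : Flow) : ℕ :=
  ∑ i, μ (Sum.inl (n, i)) c

/-- Scheduled arrival rate of flow `c` into node `n` from other nodes. -/
def inRate (μ : Rates Node Flow) (n : Node) (c : Flow) : ℕ :=
  ∑ j, μ (Sum.inl (j, n)) c

/-- Rate of flow `c` admitted from the transport layer into its source node. -/
def admitted (μ : Rates Node Flow) (c : Flow) : ℕ :=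
  μ (Sum.inr c) c

open Classical in
/-- Packets of flow `c` admitted from the transport layer into node `n`. -/
def admittedAt (net : Network Node Flow) (μ : Rates Node Flow) (n : Node) (c : Flow) : ℕ :=
  if n = net.src c then admitted μ c else 0

/-- The constraints on the rates of one slot: one packet per link, no transmission outside the
links, each virtual link carries its own flow only and at most `μM` packets, no flow is looped back
to its source, and each node takes part in at most one transmission. -/
structure Feasible (net : Network Node Flow) (μM : ℝ) (μ : Rates Node Flow) : Prop where
  link_le_one : ∀ m n c, μ (Sum.inl (m, n)) c ≤ 1
  off_links : ∀ m n c, (m, n) ∉ net.links → μ (Sum.inl (m, n)) c = 0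
  virtual_own : ∀ c c', c' ≠ c → μ (Sum.inr c) c' = 0
  admitted_le : ∀ c, (admitted μ c : ℝ) ≤ μM
  no_loop_back : ∀ m c, μ (Sum.inl (m, net.src c)) c = 0
  node_exclusive : ∀ n, ∑ c, (outRate μ n c + inRate μ n c) ≤ 1

/-! ### Long-run time averages -/

/-- `(1/t) ∑_{τ < t} f τ`. -/
def timeAvg (f : ℕ → ℝ) (t : ℕ) : ℝ :=
  (∑ τ ∈ Finset.range t, f τ) / t

/-- `limsup_t (1/t) ∑_{τ < t} f τ`, as an extended real number. -/
def limsupAvg (f : ℕ → ℝ) : EReal :=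
  limsup (fun t => ((timeAvg f t : ℝ) : EReal)) atTop

/-- `liminf_t (1/t) ∑_{τ < t} f τ`, as an extended real number. -/
def liminfAvg (f : ℕ → ℝ) : EReal :=
  liminf (fun t => ((timeAvg f t : ℝ) : EReal)) atTop

/-! ### The capacity region -/

/-- The network with rates `μ t` and backlogs `U t n c`, started empty and without any control of
the admitted traffic. A node forwards only packets that it has: by the node-exclusive constraint a
node `j` serves at most one outgoing link, on which `min (μ_{jn}^c) (U_j^c)` packets are really
transmitted. (Subtraction of natural numbers is the positive part of the difference.) -/
structure IsScheduled (net : Network Node Flow) (μM : ℝ) {Ω : Type*} [MeasurableSpace Ω]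
    (μ : ℕ → Ω → Rates Node Flow) (U : ℕ → Node → Flow → Ω → ℕ) : Prop where
  measurable_rates : ∀ t l c, Measurable fun ω => μ t ω l c
  measurable_backlog : ∀ t n c, Measurable (U t n c)
  feasible : ∀ t ω, Feasible net μM (μ t ω)
  init : ∀ n c ω, U 0 n c ω = 0
  dest : ∀ t c ω, U t (net.dst c) c ω = 0
  step : ∀ t n c ω, n ≠ net.dst c →
    U (t + 1) n c ω = (U t n c ω - outRate (μ t ω) n c)
      + (∑ j, min (μ t ω (Sum.inl (j, n)) c) (U t j c ω)) + admittedAt net (μ t ω) n c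

/-- The rate vector `z` is admissible: packets enter at the long-run rates `z_c`, and some
scheduling algorithm (possibly randomized) keeps every node backlog stable. -/
def Admissible (net : Network Node Flow) (μM : ℝ) (z : Flow → ℝ) : Prop :=
  ∃ (Ω : Type) (_ : MeasurableSpace Ω) (P : Measure Ω) (_ : IsProbabilityMeasure P)
    (μ : ℕ → Ω → Rates Node Flow) (U : ℕ → Node → Flow → Ω → ℕ),
    IsScheduled net μM μ U ∧
    (∀ c, Tendsto (timeAvg fun τ => ∫ ω, (admitted (μ τ ω) c : ℝ) ∂P) atTop (𝓝 (z c))) ∧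
    (∀ n c, limsupAvg (fun τ => ∫ ω, (U τ n c ω : ℝ) ∂P) < ⊤)

/-- The capacity region `Λ`. -/
def capacityRegion (net : Network Node Flow) (μM : ℝ) : Set (Flow → ℝ) :=
  {z | Admissible net μM z}

/-- `r` is a solution of: maximize `∑ r_c` subject to `(r_c + ε) ∈ Λ` and `r_c ≥ a_c`. -/
structure IsTightenedOptimum (net : Network Node Flow) (μM : ℝ) (a : Flow → ℝ) (ε : ℝ)
    (r : Flow → ℝ) : Prop where
  mem : (fun c => r c + ε) ∈ capacityRegion net μM
  min_rate : ∀ c, a c ≤ r c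
  optimal : ∀ r' : Flow → ℝ, (fun c => r' c + ε) ∈ capacityRegion net μM → (∀ c, a c ≤ r' c) →
    ∑ c, r' c ≤ ∑ c, r c

/-! ### The algorithm ALG -/

open Classical in
/-- The product weights `w_{mn}^c`. Flow `c` must not be sent back to its source, so it is not a
candidate (weight `0`) on links that enter `b(c)`. -/
def weight (net : Network Node Flow) (μM qM : ℝ) (U : Node → Flow → ℕ) (Us : Flow → ℝ) :
    Pair Node Flow → Flow → ℝ
  | Sum.inl (m, n), c =>
      if (m, n) ∈ net.links ∧ n ≠ net.src c then Us c / qM * ((U m c : ℝ) - (U n c : ℝ)) else 0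
  | Sum.inr c', c =>
      if c = c' then Us c / qM * (qM - μM - (U (net.src c) c : ℝ)) else 0

/-- The rates `μ` are chosen by max-weight scheduling from the weights `w`: on every pair a flow
`cs l` of maximal weight is the only candidate, the rates maximize
`∑ μ_{mn}^{c*_{mn}} [max_c w_{mn}^c]^+` under the network constraints, and pairs with
`[max_c w_{mn}^c]^+ = 0` stay idle. Ties are broken arbitrarily. -/
def IsMaxWeight (net : Network Node Flow) (μM : ℝ) (w : Pair Node Flow → Flow → ℝ)
    (μ : Rates Node Flow) : Prop :=
  ∃ cs : Pair Node Flow → Flow,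
    (∀ l c, w l c ≤ w l (cs l)) ∧
    Feasible net μM μ ∧
    (∀ l c, c ≠ cs l → μ l c = 0) ∧
    (∀ l, max (w l (cs l)) 0 = 0 → ∀ c, μ l c = 0) ∧
    (∀ ν : Rates Node Flow, Feasible net μM ν → (∀ l c, c ≠ cs l → ν l c = 0) →
      ∑ l, (ν l (cs l) : ℝ) * max (w l (cs l)) 0 ≤ ∑ l, (μ l (cs l) : ℝ) * max (w l (cs l)) 0)

/-- `R` minimizes `x ↦ x * g` over `[0, μM]`. (The rule "`0` if `g > 0`, and `μM` otherwise" is such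
a choice.) -/
def IsCongestionControl (μM g R : ℝ) : Prop :=
  (0 ≤ R ∧ R ≤ μM) ∧ ∀ x, 0 ≤ x → x ≤ μM → R * g ≤ x * g

/-- The random evolution of the network under ALG: rates `μ`, node backlogs `U`, virtual input
rates `R`, virtual queues `Us` at the transport layer, virtual delay queues `X`, and virtual service
queues `Z`. The parameters are `μM`, `qM`, `V`, the minimum rates `a`, and the delay
thresholds `ρ`. -/
structure IsALG (net : Network Node Flow) (μM qM V : ℝ) (a ρ : Flow → ℝ)
    {Ω : Type*} [MeasurableSpace Ω]
    (μ : ℕ → Ω → Rates Node Flow) (U : ℕ → Node → Flow → Ω → ℕ)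
    (R Us X Z : ℕ → Flow → Ω → ℝ) : Prop where
  measurable_rates : ∀ t l c, Measurable fun ω => μ t ω l c
  measurable_backlog : ∀ t n c, Measurable (U t n c)
  measurable_R : ∀ t c, Measurable (R t c)
  measurable_Us : ∀ t c, Measurable (Us t c)
  measurable_X : ∀ t c, Measurable (X t c)
  measurable_Z : ∀ t c, Measurable (Z t c)
  U_init : ∀ n c ω, U 0 n c ω = 0
  U_dest : ∀ t c ω, U t (net.dst c) c ω = 0
  U_step : ∀ t n c ω, n ≠ net.dst c →
    U (t + 1) n c ω ≤ (U t n c ω - outRate (μ t ω) n c)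
      + (inRate (μ t ω) n c + admittedAt net (μ t ω) n c)
  Us_init : ∀ c ω, Us 0 c ω = 0
  Us_step : ∀ t c ω,
    Us (t + 1) c ω = max (Us t c ω - (admitted (μ t ω) c : ℝ)) 0 + R t c ω
  Z_init : ∀ c ω, Z 0 c ω = 0
  Z_step : ∀ t c ω, Z (t + 1) c ω = max (Z t c ω - R t c ω) 0 + a c
  X_init : ∀ c ω, X 0 c ω = 0
  X_step : ∀ t c ω,
    X (t + 1) c ω = max (X t c ω - ρ c * R t c ω) 0 + ∑ n, (U t n c ω : ℝ)
  congestion : ∀ t c ω, IsCongestionControl μM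
    ((qM - μM) * Us t c ω / qM - X t c ω * ρ c - Z t c ω - V) (R t c ω)
  scheduling : ∀ t ω, IsMaxWeight net μM
    (weight net μM qM (fun n c => U t n c ω) (fun c => Us t c ω)) (μ t ω)

/-! ### The conditions and the constants -/

/-- `q_M > (2N - 1 + μ_M²) / (2ε) + μ_M`, and `ρ_c > N q_M / r_c` for every flow `c`. -/
def SizeCondition (Node : Type*) [Fintype Node] {Flow : Type*} (μM ε : ℝ) (r : Flow → ℝ)
    (qM : ℝ) (ρ : Flow → ℝ) : Prop :=
  (2 * (Fintype.card Node : ℝ) - 1 + μM ^ 2) / (2 * ε) + μM < qM ∧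
  ∀ c, (Fintype.card Node : ℝ) * qM / r c < ρ c

/-- The constant `B`. -/
def constB (Node : Type*) [Fintype Node] {Flow : Type*} [Fintype Flow] (μM qM : ℝ)
    (a ρ : Flow → ℝ) : ℝ :=
  let N : ℝ := Fintype.card Node
  let K : ℝ := Fintype.card Flow
  1 / 2 * N * K * qM * μM + K * ((qM - μM) / qM) * μM ^ 2 + 1 / 2 * μM ^ 2 * (∑ c, ρ c ^ 2)
    + 1 / 2 * K * N ^ 2 * qM ^ 2 + 1 / 2 * K * μM ^ 2 + 1 / 2 * K * ∑ c, a c ^ 2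

end MultiHop

end

set_option linter.unusedSectionVars false

namespace MultiHop

variable {Node Flow : Type*} [Fintype Node] [Fintype Flow]

/-! ### Max-weight scheduling -/

/-! The proof is a pathwise Lyapunov drift argument. The function `lyapunov` adds to the squares of
the virtual queues the squared node backlogs, weighted by `Us / qM`. Such a cubic term could spoil
the drift, but max-weight itself confines every backlog to `[0, qM]`: a positive weight is required
for any packet to enter a node (`IsMaxWeight.backlog_le`). The change of the factor `Us` therefore
costs only a constant, and the rest of the drift is minus the total max-weight value, plus the
congestion-control objective, plus terms linear in `X` and `Z`.

The max-weight value is compared with the capacity region directly, without stationary randomized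
policies. Freeze the current weights and run against them any algorithm that supports `z = r + ε`.
In each of its slots the transmitted packets form a feasible schedule, so their weight is at most
the max-weight value. Since the weights are frozen, the flow-conservation terms telescope to the
final backlogs, whose expectation is at most an arbitrarily small multiple of `t` infinitely often,
by stability. Dividing by `t` gives `IsMaxWeight.sum_mul_le_of_mem_capacityRegion`, a deterministic
inequality valid for every state of ALG.

Congestion control does at least as well as the constant input `r`. The terms in `Us * r` then
cancel, leaving the slack `ε` for `Us`, `ρ * r - N * qM` for `X` and `r - a` for `Z`
(`IsALG.lyapunov_succ_le`). Summing over time, `δ = 0` gives the throughput of `R`, and `δ > 0` the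
bound on the mean queues.

With `δ = 0` the Lyapunov function also grows at most linearly on every path, so the virtual queues
are `O(√t)`. These queues dominate the accumulated deficits of their constraints. Hence admitted
rates can replace `R` in the throughput bound, and the delay bound holds on every sample path. -/

lemma IsMaxWeight.feasible {net : Network Node Flow} {μM : ℝ} {w : Pair Node Flow → Flow → ℝ}
    {μ : Rates Node Flow} (h : IsMaxWeight net μM w μ) : Feasible net μM μ := by
  obtain ⟨cs, -, h, -⟩ := h
  exact h

lemma IsMaxWeight.pos_of_ne_zero {net : Network Node Flow} {μM : ℝ}
    {w : Pair Node Flow → Flow → ℝ} {μ : Rates Node Flow} (h : IsMaxWeight net μM w μ)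
    {l : Pair Node Flow} {c : Flow} (hμ : μ l c ≠ 0) : 0 < w l c := by
  obtain ⟨cs, -, -, hcs, hidle, -⟩ := h
  have hc : c = cs l := by
    by_contra hne
    exact hμ (hcs l c hne)
  by_contra hneg
  rw [hc] at hneg
  exact hμ (hidle l (max_eq_right (not_lt.mp hneg)) c)

open Classical in
/-- The rates obtained from `ν` by handing every pair `l` over to the flow `cs l`, as long as its
weight is positive. -/
noncomputable def reroute (w : Pair Node Flow → Flow → ℝ) (cs : Pair Node Flow → Flow) (ν : Rates Node Flow) :
    Rates Node Flow :=
  fun l c => if c = cs l ∧ 0 < w l c then ∑ c', ν l c' else 0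

lemma sum_reroute_le (w : Pair Node Flow → Flow → ℝ) (cs : Pair Node Flow → Flow)
    (ν : Rates Node Flow) (l : Pair Node Flow) : ∑ c, reroute w cs ν l c ≤ ∑ c, ν l c := by
  classical
  calc ∑ c, reroute w cs ν l c ≤ ∑ c, if c = cs l then ∑ c', ν l c' else 0 := by
        refine Finset.sum_le_sum fun c _ => ?_
        unfold reroute
        split_ifs <;> simp_all
    _ = ∑ c, ν l c := by simp

/-- Feasibility limits a link flow by flow; the limit over all flows together comes from node
exclusivity at the sender. -/
lemma sum_rates_link_le_one {net : Network Node Flow} {μM : ℝ} {ν : Rates Node Flow}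
    (hν : Feasible net μM ν) (m n : Node) : ∑ c, ν (Sum.inl (m, n)) c ≤ 1 := by
  refine le_trans (Finset.sum_le_sum fun c _ => ?_) (hν.node_exclusive m)
  calc ν (Sum.inl (m, n)) c ≤ outRate ν m c :=
        Finset.single_le_sum (f := fun i => ν (Sum.inl (m, i)) c) (fun _ _ => Nat.zero_le _)
          (Finset.mem_univ n)
    _ ≤ _ := Nat.le_add_right _ _

lemma sum_rates_virtual {net : Network Node Flow} {μM : ℝ} {ν : Rates Node Flow}
    (hν : Feasible net μM ν) (c : Flow) : ∑ c', ν (Sum.inr c) c' = admitted ν c := by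
  rw [Finset.sum_eq_single c (fun c' _ h => hν.virtual_own c c' h) (by simp)]
  rfl

/-- Node exclusivity sees only the totals over flows, which rerouting does not increase. The
constraints that single out a flow survive because the weight is zero on every forbidden combination
and only positive weights receive a rate. -/
lemma Feasible.reroute {net : Network Node Flow} {μM : ℝ} {ν : Rates Node Flow}
    (hν : Feasible net μM ν) {w : Pair Node Flow → Flow → ℝ} (cs : Pair Node Flow → Flow)
    (hμM : 0 ≤ μM)
    (hlink : ∀ m n c, (m, n) ∉ net.links → w (Sum.inl (m, n)) c = 0)
    (hsrc : ∀ m c, w (Sum.inl (m, net.src c)) c = 0)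
    (hvirt : ∀ c c', c' ≠ c → w (Sum.inr c) c' = 0) :
    Feasible net μM (reroute w cs ν) where
  link_le_one m n c := by
    unfold MultiHop.reroute
    split_ifs
    · exact sum_rates_link_le_one hν m n
    · exact Nat.zero_le _
  off_links m n c h := by simp [MultiHop.reroute, hlink m n c h]
  virtual_own c c' h := by simp [MultiHop.reroute, hvirt c c' h]
  admitted_le c := by
    have := hν.admitted_le c
    unfold admitted MultiHop.reroute
    split_ifs
    · rwa [sum_rates_virtual hν]
    · simpa
  no_loop_back m c := by simp [MultiHop.reroute, hsrc m c]
  node_exclusive n := by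
    refine le_trans ?_ (hν.node_exclusive n)
    simp only [outRate, inRate, Finset.sum_add_distrib]
    rw [Finset.sum_comm, Finset.sum_comm (f := fun c i => ν (Sum.inl (n, i)) c),
      Finset.sum_comm (f := fun c i => MultiHop.reroute w cs ν (Sum.inl (i, n)) c),
      Finset.sum_comm (f := fun c i => ν (Sum.inl (i, n)) c)]
    exact add_le_add (Finset.sum_le_sum fun i _ => sum_reroute_le _ _ _ _)
      (Finset.sum_le_sum fun i _ => sum_reroute_le _ _ _ _)

/-- Max-weight rates maximize the total weight over all feasible rates. -/
lemma IsMaxWeight.sum_mul_le {net : Network Node Flow} {μM : ℝ} {w : Pair Node Flow → Flow → ℝ}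
    {μ ν : Rates Node Flow} (h : IsMaxWeight net μM w μ) (hν : Feasible net μM ν) (hμM : 0 ≤ μM)
    (hlink : ∀ m n c, (m, n) ∉ net.links → w (Sum.inl (m, n)) c = 0)
    (hsrc : ∀ m c, w (Sum.inl (m, net.src c)) c = 0)
    (hvirt : ∀ c c', c' ≠ c → w (Sum.inr c) c' = 0) :
    ∑ l, ∑ c, (ν l c : ℝ) * w l c ≤ ∑ l, ∑ c, (μ l c : ℝ) * w l c := by
  obtain ⟨cs, hmax, -, hcs, hidle, hopt⟩ := h
  -- Optimality is only granted among rates that serve the candidates `cs`, so a general `ν` has to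
  -- be rerouted first; this cannot lower its total weight.
  have key := hopt (reroute w cs ν) (hν.reroute cs hμM hlink hsrc hvirt)
    (fun l c hc => by simp [reroute, hc])
  calc ∑ l, ∑ c, (ν l c : ℝ) * w l c
      ≤ ∑ l, (reroute w cs ν l (cs l) : ℝ) * max (w l (cs l)) 0 := by
        refine Finset.sum_le_sum fun l _ => ?_
        calc ∑ c, (ν l c : ℝ) * w l c ≤ ∑ c, (ν l c : ℝ) * max (w l (cs l)) 0 :=
              Finset.sum_le_sum fun c _ => mul_le_mul_of_nonneg_left
                ((hmax l c).trans (le_max_left _ _)) (Nat.cast_nonneg _)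
          _ = (reroute w cs ν l (cs l) : ℝ) * max (w l (cs l)) 0 := by
              rw [← Finset.sum_mul]
              by_cases hpos : 0 < w l (cs l)
              · simp [reroute, hpos]
              · simp [max_eq_right (not_lt.mp hpos)]
    _ ≤ ∑ l, (μ l (cs l) : ℝ) * max (w l (cs l)) 0 := key
    _ = ∑ l, ∑ c, (μ l c : ℝ) * w l c := by
        refine Finset.sum_congr rfl fun l _ => ?_
        rw [Finset.sum_eq_single (cs l) (fun c _ hc => by simp [hcs l c hc]) (by simp)]
        by_cases hpos : 0 < w l (cs l)
        · rw [max_eq_left hpos.le]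
        · simp [hidle l (max_eq_right (not_lt.mp hpos))]

/-! ### The product weights -/

lemma weight_eq_zero_of_notMem_links (net : Network Node Flow) (μM qM : ℝ) (U : Node → Flow → ℕ)
    (S : Flow → ℝ) (m n : Node) (c : Flow) (h : (m, n) ∉ net.links) :
    weight net μM qM U S (Sum.inl (m, n)) c = 0 := by
  simp [weight, h]

lemma weight_src_eq_zero (net : Network Node Flow) (μM qM : ℝ) (U : Node → Flow → ℕ)
    (S : Flow → ℝ) (m : Node) (c : Flow) :
    weight net μM qM U S (Sum.inl (m, net.src c)) c = 0 := by
  simp [weight]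

lemma weight_virtual_of_ne (net : Network Node Flow) (μM qM : ℝ) (U : Node → Flow → ℕ)
    (S : Flow → ℝ) (c c' : Flow) (h : c' ≠ c) :
    weight net μM qM U S (Sum.inr c) c' = 0 := by
  simp [weight, h]

/-- The total weight of feasible rates, sorted by flows and nodes. -/
lemma Feasible.sum_mul_weight {net : Network Node Flow} {μM : ℝ} {μ : Rates Node Flow}
    (h : Feasible net μM μ) (qM : ℝ) (U : Node → Flow → ℕ) (S : Flow → ℝ) :
    ∑ l, ∑ c, (μ l c : ℝ) * weight net μM qM U S l c =
      ∑ c, S c / qM * ((admitted μ c : ℝ) * (qM - μM) + ∑ n, (U n c : ℝ) *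
        ((outRate μ n c : ℝ) - (inRate μ n c : ℝ) - (admittedAt net μ n c : ℝ))) := by
  classical
  rw [Finset.sum_comm]
  refine Finset.sum_congr rfl fun c _ => ?_
  rw [Fintype.sum_sum_type, Fintype.sum_prod_type]
  have hv : ∑ c', (μ (Sum.inr c') c : ℝ) * weight net μM qM U S (Sum.inr c') c =
      S c / qM * ((admitted μ c : ℝ) * (qM - μM - (U (net.src c) c : ℝ))) := by
    rw [Finset.sum_eq_single c (fun c' _ hc => by simp [h.virtual_own c' c (Ne.symm hc)])
      (by simp)]
    simp only [weight, admitted, if_true]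
    ring
  have hl : ∀ m n, (μ (Sum.inl (m, n)) c : ℝ) * weight net μM qM U S (Sum.inl (m, n)) c =
      S c / qM * ((U m c : ℝ) * (μ (Sum.inl (m, n)) c : ℝ)) -
      S c / qM * ((U n c : ℝ) * (μ (Sum.inl (m, n)) c : ℝ)) := by
    intro m n
    by_cases hmn : (m, n) ∈ net.links
    · by_cases hn : n = net.src c
      · subst hn
        simp [h.no_loop_back m c]
      · simp only [weight, hmn, hn, ne_eq, not_false_eq_true, and_self, if_true]
        ring
    · simp [h.off_links m n c hmn]
  have hadm : ∑ n, (U n c : ℝ) * (admittedAt net μ n c : ℝ) =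
      (U (net.src c) c : ℝ) * (admitted μ c : ℝ) := by
    simp [admittedAt]
  rw [hv]
  simp only [hl, mul_sub, Finset.sum_sub_distrib]
  rw [hadm, Finset.sum_comm (f := fun m n => S c / qM * ((U n c : ℝ) *
    (μ (Sum.inl (m, n)) c : ℝ)))]
  simp only [outRate, inRate, Nat.cast_sum, ← Finset.mul_sum]
  ring

/-! ### The backlogs stay bounded -/

lemma Feasible.outRate_add_inRate_le_one {net : Network Node Flow} {μM : ℝ} {μ : Rates Node Flow}
    (h : Feasible net μM μ) (n : Node) (c : Flow) : outRate μ n c + inRate μ n c ≤ 1 :=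
  (Finset.single_le_sum (f := fun c => outRate μ n c + inRate μ n c) (fun _ _ => Nat.zero_le _)
    (Finset.mem_univ c)).trans (h.node_exclusive n)

/-- Under max-weight scheduling with the product weights, backlogs bounded by `qM` remain so. -/
lemma IsMaxWeight.backlog_le {net : Network Node Flow} {μM qM : ℝ} {U : Node → Flow → ℕ}
    {S : Flow → ℝ} {μ : Rates Node Flow} (h : IsMaxWeight net μM (weight net μM qM U S) μ)
    (hq : 0 < qM) (hS : ∀ c, 0 ≤ S c) (hU : ∀ n c, (U n c : ℝ) ≤ qM) {n : Node} {c : Flow} {u : ℕ}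
    (hu : u ≤ (U n c - outRate μ n c) + (inRate μ n c + admittedAt net μ n c)) :
    (u : ℝ) ≤ qM := by
  have hf := h.feasible
  have hle : u ≤ U n c + (inRate μ n c + admittedAt net μ n c) := by omega
  by_cases hin : inRate μ n c = 0
  · by_cases had : admittedAt net μ n c = 0
    · rw [hin, had] at hle
      exact le_trans (by exact_mod_cast hle) (hU n c)
    · have hn : n = net.src c := by
        by_contra hne
        simp [admittedAt, hne] at had
      subst hn
      have had' : admittedAt net μ (net.src c) c = admitted μ c := by simp [admittedAt]
      rw [had'] at had hle
      -- Admission requires a source backlog below `qM - μM`, which leaves room for the at most `μM`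
      -- new packets.
      have hpos := h.pos_of_ne_zero (l := Sum.inr c) (c := c) had
      simp only [weight, if_true] at hpos
      have hlt := pos_of_mul_pos_right hpos (div_nonneg (hS c) hq.le)
      have h1 := hf.admitted_le c
      have h2 : (u : ℝ) ≤ U (net.src c) c + (admitted μ c : ℝ) := by
        rw [hin, zero_add] at hle
        exact_mod_cast hle
      linarith
  · obtain ⟨j, -, hj⟩ := Finset.exists_ne_zero_of_sum_ne_zero hin
    -- A packet arrives from `j` only if `j` has strictly more packets than `n`. Backlogs are
    -- integers and at most one packet arrives, so the new backlog is at most that of `j`;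
    -- positivity also rules out that `n` is the source, so nothing is admitted here.
    have hpos := h.pos_of_ne_zero hj
    simp only [weight] at hpos
    split_ifs at hpos with hcond
    · have hlt := pos_of_mul_pos_right hpos (div_nonneg (hS c) hq.le)
      have hlt' : U n c < U j c := by
        have : (U n c : ℝ) < U j c := by linarith
        exact_mod_cast this
      have had : admittedAt net μ n c = 0 := by simp [admittedAt, hcond.2]
      have h1 := hf.outRate_add_inRate_le_one n c
      have : u ≤ U j c := by omega
      exact le_trans (by exact_mod_cast this) (hU j c)
    · exact absurd hpos (lt_irrefl _)

/-! ### Time averages -/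

lemma timeAvg_le_of_forall_le {f : ℕ → ℝ} {C : ℝ} (hC : 0 ≤ C) (h : ∀ t, f t ≤ C) (t : ℕ) :
    timeAvg f t ≤ C := by
  unfold timeAvg
  refine div_le_of_le_mul₀ (Nat.cast_nonneg t) hC ?_
  calc ∑ τ ∈ Finset.range t, f τ ≤ ∑ _τ ∈ Finset.range t, C := Finset.sum_le_sum fun τ _ => h τ
    _ = C * t := by simp [mul_comm]

/-- A sequence with bounded time averages is infinitely often below any line of positive slope. -/
lemma frequently_le_mul_of_timeAvg_le {f : ℕ → ℝ} (hf : ∀ t, 0 ≤ f t) {C : ℝ}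
    (hC : ∀ᶠ t in atTop, timeAvg f t ≤ C) {η : ℝ} (hη : 0 < η) :
    ∃ᶠ t in atTop, f t ≤ η * t := by
  intro hcon
  obtain ⟨T₁, hT₁⟩ := eventually_atTop.mp hC
  obtain ⟨T₂, hT₂⟩ := eventually_atTop.mp hcon
  -- If `f` stays above the line, its sum over `[t, 2t)` is at least `η * t ^ 2`, while the averages
  -- allow only `2 * C * t`; this is absurd once `t > 2 * C / η`.
  obtain ⟨T₃, hT₃⟩ := exists_nat_gt (2 * C / η)
  set t := max (max T₁ T₂) (T₃ + 1) with ht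
  have ht1 : T₁ ≤ t := (le_max_left _ _).trans (le_max_left _ _)
  have ht2 : T₂ ≤ t := (le_max_right _ _).trans (le_max_left _ _)
  have ht3 : T₃ + 1 ≤ t := le_max_right _ _
  have ht0 : (0 : ℝ) < t := by
    have : 0 < t := by omega
    exact_mod_cast this
  have htC : 2 * C < η * t := by
    have h1 : (T₃ : ℝ) ≤ t := by exact_mod_cast (by omega : T₃ ≤ t)
    rw [div_lt_iff₀ hη] at hT₃
    nlinarith
  have havg := hT₁ (2 * t) (by omega)
  unfold timeAvg at havg
  have h2t : (0 : ℝ) < ((2 * t : ℕ) : ℝ) := by push_cast; linarith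
  rw [div_le_iff₀ h2t, two_mul, Finset.sum_range_add] at havg
  have hlow : (t : ℝ) * (η * t) ≤ ∑ i ∈ Finset.range t, f (t + i) := by
    calc (t : ℝ) * (η * t) = ∑ _i ∈ Finset.range t, η * (t : ℝ) := by simp
      _ ≤ _ := by
        refine Finset.sum_le_sum fun i _ => ?_
        have h3 := not_le.mp (hT₂ (t + i) (by omega))
        have h4 : η * (t : ℝ) ≤ η * ((t + i : ℕ) : ℝ) :=
          mul_le_mul_of_nonneg_left (by exact_mod_cast Nat.le_add_right t i) hη.le
        linarith
  have h0 : 0 ≤ ∑ i ∈ Finset.range t, f i := Finset.sum_nonneg fun i _ => hf i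
  push_cast at havg
  nlinarith

lemma exists_timeAvg_le_of_limsupAvg_lt_top {f : ℕ → ℝ} (h : limsupAvg f < ⊤) :
    ∃ C : ℝ, ∀ᶠ t in atTop, timeAvg f t ≤ C := by
  obtain ⟨C, hC, -⟩ := EReal.lt_iff_exists_real_btwn.mp h
  refine ⟨C, (eventually_lt_of_limsup_lt hC).mono fun t ht => ?_⟩
  exact_mod_cast ht.le

lemma timeAvg_sum {ι : Type*} (s : Finset ι) (f : ι → ℕ → ℝ) (t : ℕ) :
    timeAvg (fun τ => ∑ i ∈ s, f i τ) t = ∑ i ∈ s, timeAvg (f i) t := by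
  unfold timeAvg
  rw [Finset.sum_comm, Finset.sum_div]

/-! ### Scheduling algorithms of the capacity region -/

lemma Feasible.mono {net : Network Node Flow} {μM : ℝ} {μ ν : Rates Node Flow}
    (h : Feasible net μM μ) (hν : ∀ l c, ν l c ≤ μ l c) : Feasible net μM ν where
  link_le_one m n c := (hν _ _).trans (h.link_le_one m n c)
  off_links m n c hmn := Nat.le_zero.mp ((hν _ _).trans (h.off_links m n c hmn).le)
  virtual_own c c' hc := Nat.le_zero.mp ((hν _ _).trans (h.virtual_own c c' hc).le)
  admitted_le c := le_trans (by exact_mod_cast hν (Sum.inr c) c) (h.admitted_le c)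
  no_loop_back m c := Nat.le_zero.mp ((hν _ _).trans (h.no_loop_back m c).le)
  node_exclusive n := (Finset.sum_le_sum fun c _ => add_le_add
    (Finset.sum_le_sum fun i _ => hν _ _) (Finset.sum_le_sum fun i _ => hν _ _)).trans
    (h.node_exclusive n)

/-- The rates at which packets are really transmitted. -/
def transmitted (μ : Rates Node Flow) (U : Node → Flow → ℕ) : Rates Node Flow
  | Sum.inl (j, n), c => min (μ (Sum.inl (j, n)) c) (U j c)
  | Sum.inr c', c => μ (Sum.inr c') c

lemma transmitted_le (μ : Rates Node Flow) (U : Node → Flow → ℕ) (l : Pair Node Flow) (c : Flow) :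
    transmitted μ U l c ≤ μ l c := by
  rcases l with ⟨j, n⟩ | c'
  · exact min_le_left _ _
  · exact le_rfl

/-- An empty node transmits nothing, and a nonempty one sends at most one packet, which it has. So
truncated subtraction removes exactly the transmitted packets. -/
lemma Feasible.sub_outRate {net : Network Node Flow} {μM : ℝ} {μ : Rates Node Flow}
    (h : Feasible net μM μ) (U : Node → Flow → ℕ) (n : Node) (c : Flow) :
    ((U n c - outRate μ n c : ℕ) : ℝ) = (U n c : ℝ) - (outRate (transmitted μ U) n c : ℝ) := by
  rcases Nat.eq_zero_or_pos (U n c) with hU | hU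
  · simp [outRate, transmitted, hU]
  · have h1 : outRate (transmitted μ U) n c = outRate μ n c :=
      Finset.sum_congr rfl fun i _ => min_eq_left ((h.link_le_one n i c).trans hU)
    have h2 := h.outRate_add_inRate_le_one n c
    rw [h1, Nat.cast_sub (by omega)]

section Scheduled

variable {net : Network Node Flow} {μM : ℝ} {Ω : Type*} [MeasurableSpace Ω]
  {μ : ℕ → Ω → Rates Node Flow} {U : ℕ → Node → Flow → Ω → ℕ}

/-- Written with transmitted rates, the truncated recursion becomes an exact linear conservation
law, which can be telescoped. -/
lemma IsScheduled.backlog_succ_sub (h : IsScheduled net μM μ U) (t : ℕ) {n : Node} {c : Flow}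
    (hn : n ≠ net.dst c) (ω : Ω) :
    (U (t + 1) n c ω : ℝ) - (U t n c ω : ℝ) =
      -((outRate (transmitted (μ t ω) fun n c => U t n c ω) n c : ℝ)
        - (inRate (transmitted (μ t ω) fun n c => U t n c ω) n c : ℝ)
        - (admittedAt net (transmitted (μ t ω) fun n c => U t n c ω) n c : ℝ)) := by
  have h1 := (h.feasible t ω).sub_outRate (fun n c => U t n c ω) n c
  rw [h.step t n c ω hn, Nat.cast_add, Nat.cast_add, h1]
  simp only [inRate, admittedAt, admitted, transmitted]
  ring

lemma IsScheduled.measurable_admitted (h : IsScheduled net μM μ U) (t : ℕ) (c : Flow) :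
    Measurable fun ω => (admitted (μ t ω) c : ℝ) :=
  measurable_from_top.comp (h.measurable_rates t (Sum.inr c) c)

lemma IsScheduled.integrable_admitted (h : IsScheduled net μM μ U) (P : Measure Ω)
    [IsProbabilityMeasure P] (t : ℕ) (c : Flow) :
    Integrable (fun ω => (admitted (μ t ω) c : ℝ)) P := by
  refine Integrable.of_bound (h.measurable_admitted t c).aestronglyMeasurable μM
    (Eventually.of_forall fun ω => ?_)
  rw [Real.norm_of_nonneg (Nat.cast_nonneg _)]
  exact (h.feasible t ω).admitted_le c

lemma IsScheduled.backlog_le (h : IsScheduled net μM μ U) (hμM : 0 ≤ μM) (t : ℕ) (n : Node)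
    (c : Flow) (ω : Ω) : (U t n c ω : ℝ) ≤ t * (1 + μM) := by
  induction t with
  | zero => simp [h.init]
  | succ t ih =>
    by_cases hn : n = net.dst c
    · rw [hn, h.dest, Nat.cast_zero]
      positivity
    · have hf := (h.feasible t ω).mono (transmitted_le (μ t ω) fun n c => U t n c ω)
      have h1 := h.backlog_succ_sub t hn ω
      have h2 := hf.outRate_add_inRate_le_one n c
      have h2' : (inRate (transmitted (μ t ω) fun n c => U t n c ω) n c : ℝ) ≤ 1 := by
        exact_mod_cast (by omega :
          inRate (transmitted (μ t ω) fun n c => U t n c ω) n c ≤ 1)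
      have h3 : (admittedAt net (transmitted (μ t ω) fun n c => U t n c ω) n c : ℝ) ≤ μM := by
        unfold admittedAt
        split_ifs
        · exact hf.admitted_le c
        · simpa
      have h4 : (0 : ℝ) ≤ outRate (transmitted (μ t ω) fun n c => U t n c ω) n c :=
        Nat.cast_nonneg _
      push_cast
      linarith

lemma IsScheduled.integrable_backlog (h : IsScheduled net μM μ U) (hμM : 0 ≤ μM) (P : Measure Ω)
    [IsProbabilityMeasure P] (t : ℕ) (n : Node) (c : Flow) :
    Integrable (fun ω => (U t n c ω : ℝ)) P := by
  refine Integrable.of_bound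
    (measurable_from_top.comp (h.measurable_backlog t n c)).aestronglyMeasurable
    (t * (1 + μM)) (Eventually.of_forall fun ω => ?_)
  rw [Real.norm_of_nonneg (Nat.cast_nonneg _)]
  exact h.backlog_le hμM t n c ω

/-- Any scheduling algorithm is dominated by max-weight rates, up to its final backlogs. -/
lemma IsScheduled.sum_admitted_le (h : IsScheduled net μM μ U) (hμM : 0 ≤ μM) {qM : ℝ}
    (hq : 0 < qM) {u : Node → Flow → ℕ} {S : Flow → ℝ} {μ' : Rates Node Flow}
    (hmw : IsMaxWeight net μM (weight net μM qM u S) μ')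
    (hS : ∀ c, 0 ≤ S c) (hu : ∀ n c, (u n c : ℝ) ≤ qM) (hdst : ∀ c, u (net.dst c) c = 0)
    (t : ℕ) (ω : Ω) :
    ∑ c, S c * ((qM - μM) / qM) * ∑ τ ∈ Finset.range t, (admitted (μ τ ω) c : ℝ) ≤
      t * (∑ l, ∑ c, (μ' l c : ℝ) * weight net μM qM u S l c) +
        ∑ c, S c * ∑ n, (U t n c ω : ℝ) := by
  set M := ∑ l, ∑ c, (μ' l c : ℝ) * weight net μM qM u S l c
  have hslot : ∀ τ, ∑ c, S c / qM * ((admitted (μ τ ω) c : ℝ) * (qM - μM) -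
      ∑ n, (u n c : ℝ) * ((U (τ + 1) n c ω : ℝ) - (U τ n c ω : ℝ))) ≤ M := by
    intro τ
    have hf := (h.feasible τ ω).mono (transmitted_le (μ τ ω) fun n c => U τ n c ω)
    have hle := hmw.sum_mul_le hf hμM (weight_eq_zero_of_notMem_links net μM qM u S)
      (weight_src_eq_zero net μM qM u S) (weight_virtual_of_ne net μM qM u S)
    rw [hf.sum_mul_weight] at hle
    refine le_trans (le_of_eq ?_) hle
    refine Finset.sum_congr rfl fun c _ => ?_
    rw [sub_eq_add_neg, ← Finset.sum_neg_distrib]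
    congr 2
    refine Finset.sum_congr rfl fun n _ => ?_
    -- Conservation fails at the destination, where packets leave the network, but there the frozen
    -- weight `u` vanishes.
    by_cases hn : n = net.dst c
    · simp [hn, hdst]
    · rw [h.backlog_succ_sub τ hn ω]
      ring
  have htot : ∑ τ ∈ Finset.range t, ∑ c, S c / qM * ((admitted (μ τ ω) c : ℝ) * (qM - μM) -
      ∑ n, (u n c : ℝ) * ((U (τ + 1) n c ω : ℝ) - (U τ n c ω : ℝ))) ≤ t * M := by
    calc _ ≤ ∑ _τ ∈ Finset.range t, M := Finset.sum_le_sum fun τ _ => hslot τ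
      _ = t * M := by simp
  rw [Finset.sum_comm] at htot
  rw [← sub_le_iff_le_add, ← Finset.sum_sub_distrib]
  refine le_trans (Finset.sum_le_sum fun c _ => ?_) htot
  rw [← Finset.mul_sum, Finset.sum_sub_distrib, ← Finset.sum_mul,
    Finset.sum_comm (s := Finset.range t)]
  have htel : ∀ n, ∑ τ ∈ Finset.range t,
      (u n c : ℝ) * ((U (τ + 1) n c ω : ℝ) - (U τ n c ω : ℝ)) = (u n c : ℝ) * (U t n c ω : ℝ) := by
    intro n
    rw [← Finset.mul_sum, Finset.sum_range_sub (fun τ => (U τ n c ω : ℝ)), h.init]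
    simp
  simp only [htel]
  have hb : ∑ n, (u n c : ℝ) * (U t n c ω : ℝ) ≤ qM * ∑ n, (U t n c ω : ℝ) := by
    rw [Finset.mul_sum]
    exact Finset.sum_le_sum fun n _ => mul_le_mul_of_nonneg_right (hu n c) (Nat.cast_nonneg _)
  have hSq : 0 ≤ S c / qM := div_nonneg (hS c) hq.le
  have hmul := mul_le_mul_of_nonneg_left hb hSq
  have e1 : S c / qM * (qM * ∑ n, (U t n c ω : ℝ)) = S c * ∑ n, (U t n c ω : ℝ) := by
    field_simp
  have e2 : S c * ((qM - μM) / qM) * ∑ τ ∈ Finset.range t, (admitted (μ τ ω) c : ℝ) =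
      S c / qM * ((∑ τ ∈ Finset.range t, (admitted (μ τ ω) c : ℝ)) * (qM - μM)) := by
    ring
  rw [e2, mul_sub]
  linarith

end Scheduled

/-! ### The capacity region -/

/-- Needed so that the target rate `r c` is an admissible competitor in the congestion-control
minimization over `[0, μM]`. -/
lemma le_of_mem_capacityRegion {net : Network Node Flow} {μM : ℝ} (hμM : 0 ≤ μM) {z : Flow → ℝ}
    (hz : z ∈ capacityRegion net μM) (c : Flow) : z c ≤ μM := by
  obtain ⟨Ω, _, P, _, μ, U, h, hlim, -⟩ := hz
  refine le_of_tendsto' (hlim c) fun t => timeAvg_le_of_forall_le hμM (fun τ => ?_) t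
  calc ∫ ω, (admitted (μ τ ω) c : ℝ) ∂P ≤ ∫ _ω, μM ∂P :=
        integral_mono (h.integrable_admitted P τ c) (integrable_const _)
          fun ω => (h.feasible τ ω).admitted_le c
    _ = μM := by simp

/-- The total weight under max-weight scheduling dominates every rate vector of the capacity
region. -/
lemma IsMaxWeight.sum_mul_le_of_mem_capacityRegion {net : Network Node Flow} {μM : ℝ}
    (hμM : 0 ≤ μM) {z : Flow → ℝ} (hz : z ∈ capacityRegion net μM) {qM : ℝ} (hq : 0 < qM)
    {u : Node → Flow → ℕ} {S : Flow → ℝ} {μ' : Rates Node Flow}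
    (hmw : IsMaxWeight net μM (weight net μM qM u S) μ')
    (hS : ∀ c, 0 ≤ S c) (hu : ∀ n c, (u n c : ℝ) ≤ qM) (hdst : ∀ c, u (net.dst c) c = 0) :
    ∑ c, S c * ((qM - μM) / qM) * z c ≤ ∑ l, ∑ c, (μ' l c : ℝ) * weight net μM qM u S l c := by
  obtain ⟨Ω, _, P, _, μ, U, h, hlim, hstab⟩ := hz
  set M := ∑ l, ∑ c, (μ' l c : ℝ) * weight net μM qM u S l c
  have hint : ∀ t : ℕ, ∑ c, S c * ((qM - μM) / qM) *
      ∑ τ ∈ Finset.range t, ∫ ω, (admitted (μ τ ω) c : ℝ) ∂P ≤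
      t * M + ∑ c, S c * ∑ n, ∫ ω, (U t n c ω : ℝ) ∂P := by
    intro t
    have hi1 : ∀ c, Integrable (fun ω => S c * ((qM - μM) / qM) *
        ∑ τ ∈ Finset.range t, (admitted (μ τ ω) c : ℝ)) P := fun c =>
      (integrable_finsetSum _ fun τ _ => h.integrable_admitted P τ c).const_mul _
    have hi2 : ∀ c, Integrable (fun ω => S c * ∑ n, (U t n c ω : ℝ)) P := fun c =>
      (integrable_finsetSum _ fun n _ => h.integrable_backlog hμM P t n c).const_mul _
    have hmono := integral_mono (μ := P) (integrable_finsetSum Finset.univ fun c _ => hi1 c)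
      ((integrable_const ((t : ℝ) * M)).add (integrable_finsetSum Finset.univ fun c _ => hi2 c))
      (fun ω => h.sum_admitted_le hμM hq hmw hS hu hdst t ω)
    simp only [Pi.add_apply] at hmono
    rw [integral_finsetSum _ (fun c _ => hi1 c),
      integral_add (integrable_const _) (integrable_finsetSum _ fun c _ => hi2 c),
      integral_finsetSum _ (fun c _ => hi2 c)] at hmono
    simp only [integral_const_mul, integral_const, probReal_univ, one_smul] at hmono
    simp only [integral_finsetSum _ (fun τ _ => h.integrable_admitted P τ _),
      integral_finsetSum _ (fun n _ => h.integrable_backlog hμM P t n _)] at hmono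
    exact hmono
  set f : ℕ → ℝ := fun t => ∑ n, ∑ c, ∫ ω, (U t n c ω : ℝ) ∂P with hf_def
  have hE : ∀ t n c, 0 ≤ ∫ ω, (U t n c ω : ℝ) ∂P := fun t n c =>
    integral_nonneg fun ω => Nat.cast_nonneg _
  have hf0 : ∀ t, 0 ≤ f t := fun t => Finset.sum_nonneg fun n _ => Finset.sum_nonneg fun c _ =>
    hE t n c
  have hfC : ∃ C : ℝ, ∀ᶠ t in atTop, timeAvg f t ≤ C := by
    choose C hC using fun n c => exists_timeAvg_le_of_limsupAvg_lt_top (hstab n c)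
    refine ⟨∑ n, ∑ c, C n c, ?_⟩
    have hall : ∀ᶠ t in atTop, ∀ n c,
        timeAvg (fun τ => ∫ ω, (U τ n c ω : ℝ) ∂P) t ≤ C n c :=
      eventually_all.mpr fun n => eventually_all.mpr fun c => hC n c
    filter_upwards [hall] with t ht
    rw [hf_def, timeAvg_sum]
    refine Finset.sum_le_sum fun n _ => ?_
    rw [timeAvg_sum]
    exact Finset.sum_le_sum fun c _ => ht n c
  obtain ⟨C, hC⟩ := hfC
  have hlimS : Tendsto (fun t => ∑ c, S c * ((qM - μM) / qM) *
      timeAvg (fun τ => ∫ ω, (admitted (μ τ ω) c : ℝ) ∂P) t) atTop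
      (𝓝 (∑ c, S c * ((qM - μM) / qM) * z c)) :=
    tendsto_finsetSum _ fun c _ => (hlim c).const_mul _
  have hS0 : 0 ≤ ∑ c, S c := Finset.sum_nonneg fun c _ => hS c
  -- Bounded averages do not force the mean backlog at time `t` to be `o(t)`, only to be at most `η
  -- * t` infinitely often. This suffices, because the left side converges. The `+ 1` in `η` covers
  -- the case that all `S c` are zero.
  refine le_of_forall_pos_le_add fun e he => ?_
  have hη : 0 < e / (∑ c, S c + 1) := by positivity
  refine le_of_tendsto_of_frequently hlimS ?_
  refine ((frequently_le_mul_of_timeAvg_le hf0 hC hη).and_eventually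
    (eventually_gt_atTop 0)).mono fun t ht => ?_
  obtain ⟨ht, htpos⟩ := ht
  have htpos' : (0 : ℝ) < t := by exact_mod_cast htpos
  have hcalc : ∑ c, S c * ∑ n, ∫ ω, (U t n c ω : ℝ) ∂P ≤ e * t := by
    calc ∑ c, S c * ∑ n, ∫ ω, (U t n c ω : ℝ) ∂P ≤ ∑ c, S c * f t := by
          refine Finset.sum_le_sum fun c _ => mul_le_mul_of_nonneg_left ?_ (hS c)
          exact Finset.sum_le_sum fun n _ => Finset.single_le_sum
            (f := fun c => ∫ ω, (U t n c ω : ℝ) ∂P) (fun c _ => hE t n c) (Finset.mem_univ c)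
      _ = (∑ c, S c) * f t := by rw [Finset.sum_mul]
      _ ≤ (∑ c, S c) * (e / (∑ c, S c + 1) * t) := mul_le_mul_of_nonneg_left ht hS0
      _ = (∑ c, S c) / (∑ c, S c + 1) * (e * t) := by ring
      _ ≤ 1 * (e * t) := by
          refine mul_le_mul_of_nonneg_right ?_ (by positivity)
          rw [div_le_one (by positivity)]
          linarith
      _ = e * t := one_mul _
  have hfin := (hint t).trans (add_le_add_right hcalc _)
  have hsum : ∑ c, S c * ((qM - μM) / qM) *
      timeAvg (fun τ => ∫ ω, (admitted (μ τ ω) c : ℝ) ∂P) t =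
      (∑ c, S c * ((qM - μM) / qM) *
        ∑ τ ∈ Finset.range t, ∫ ω, (admitted (μ τ ω) c : ℝ) ∂P) / t := by
    rw [Finset.sum_div]
    exact Finset.sum_congr rfl fun c _ => by unfold timeAvg; ring
  rw [hsum, div_le_iff₀ htpos']
  linarith

/-! ### Lyapunov drift of ALG -/

/-- The quadratic drift of a queue with backlog `q`, service `s` and arrivals `b`. -/
lemma sq_le_of_le_max_add {x q s b : ℝ} (hx : 0 ≤ x) (hq : 0 ≤ q) (hs : 0 ≤ s) (hb : 0 ≤ b)
    (h : x ≤ max (q - s) 0 + b) : x ^ 2 ≤ q ^ 2 + s ^ 2 + b ^ 2 - 2 * (q * (s - b)) := by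
  have h1 : x ^ 2 ≤ (max (q - s) 0 + b) ^ 2 := pow_le_pow_left₀ hx h 2
  have h2 : max (q - s) 0 ^ 2 ≤ (q - s) ^ 2 := by
    rcases le_total (q - s) 0 with h0 | h0
    · rw [max_eq_right h0]
      nlinarith
    · rw [max_eq_left h0]
  have h3 : max (q - s) 0 * b ≤ q * b :=
    mul_le_mul_of_nonneg_right (max_le (by linarith) hq) hb
  nlinarith

/-- The quadratic Lyapunov function, in which the squared backlogs of the nodes are weighted with
the transport-layer queue. -/
noncomputable def lyapunov (μM qM : ℝ) (u : Node → Flow → ℕ) (S X Z : Flow → ℝ) : ℝ :=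
  ∑ c, ((qM - μM) / qM * S c ^ 2 + X c ^ 2 + Z c ^ 2 + S c / qM * ∑ n, (u n c : ℝ) ^ 2) / 2

section ALG

variable {net : Network Node Flow} {μM qM V : ℝ} {a ρ : Flow → ℝ} {Ω : Type*} [MeasurableSpace Ω]
  {μ : ℕ → Ω → Rates Node Flow} {U : ℕ → Node → Flow → Ω → ℕ} {R Us X Z : ℕ → Flow → Ω → ℝ}

lemma IsALG.R_nonneg (h : IsALG net μM qM V a ρ μ U R Us X Z) (t : ℕ) (c : Flow) (ω : Ω) :
    0 ≤ R t c ω := (h.congestion t c ω).1.1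

lemma IsALG.R_le (h : IsALG net μM qM V a ρ μ U R Us X Z) (t : ℕ) (c : Flow) (ω : Ω) :
    R t c ω ≤ μM := (h.congestion t c ω).1.2

lemma IsALG.feasible (h : IsALG net μM qM V a ρ μ U R Us X Z) (t : ℕ) (ω : Ω) :
    Feasible net μM (μ t ω) := (h.scheduling t ω).feasible

lemma IsALG.Us_nonneg (h : IsALG net μM qM V a ρ μ U R Us X Z) (t : ℕ) (c : Flow) (ω : Ω) :
    0 ≤ Us t c ω := by
  cases t with
  | zero => exact (h.Us_init c ω).ge
  | succ t =>
    rw [h.Us_step]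
    exact add_nonneg (le_max_right _ _) (h.R_nonneg t c ω)

lemma IsALG.X_nonneg (h : IsALG net μM qM V a ρ μ U R Us X Z) (t : ℕ) (c : Flow) (ω : Ω) :
    0 ≤ X t c ω := by
  cases t with
  | zero => exact (h.X_init c ω).ge
  | succ t =>
    rw [h.X_step]
    exact add_nonneg (le_max_right _ _) (Finset.sum_nonneg fun n _ => Nat.cast_nonneg _)

lemma IsALG.Z_nonneg (h : IsALG net μM qM V a ρ μ U R Us X Z) (ha : ∀ c, 0 ≤ a c) (t : ℕ)
    (c : Flow) (ω : Ω) : 0 ≤ Z t c ω := by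
  cases t with
  | zero => exact (h.Z_init c ω).ge
  | succ t =>
    rw [h.Z_step]
    exact add_nonneg (le_max_right _ _) (ha c)

lemma IsALG.backlog_le (h : IsALG net μM qM V a ρ μ U R Us X Z) (hq : 0 < qM) (t : ℕ) (n : Node)
    (c : Flow) (ω : Ω) : (U t n c ω : ℝ) ≤ qM := by
  induction t generalizing n c with
  | zero => simpa [h.U_init] using hq.le
  | succ t ih =>
    by_cases hn : n = net.dst c
    · simpa [hn, h.U_dest] using hq.le
    · exact (h.scheduling t ω).backlog_le hq (fun c => h.Us_nonneg t c ω) ih (h.U_step t n c ω hn)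

lemma IsALG.sum_backlog_le (h : IsALG net μM qM V a ρ μ U R Us X Z) (hq : 0 < qM) (t : ℕ)
    (c : Flow) (ω : Ω) : ∑ n, (U t n c ω : ℝ) ≤ Fintype.card Node * qM := by
  calc ∑ n, (U t n c ω : ℝ) ≤ ∑ _n : Node, qM :=
        Finset.sum_le_sum fun n _ => h.backlog_le hq t n c ω
    _ = Fintype.card Node * qM := by simp

/-- Away from the source a node either sends or receives at most one packet, contributing at most
`1`. The source receives only admitted traffic, since nothing is looped back, and contributes at
most `1 + μM ^ 2`. -/
lemma Feasible.sum_sq_rates_le {ν : Rates Node Flow} (h : Feasible net μM ν)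
    (c : Flow) :
    ∑ n, ((outRate ν n c : ℝ) ^ 2 + ((inRate ν n c + admittedAt net ν n c : ℕ) : ℝ) ^ 2) ≤
      Fintype.card Node + μM ^ 2 := by
  classical
  calc _ ≤ ∑ n, (1 + if n = net.src c then μM ^ 2 else 0) := by
        refine Finset.sum_le_sum fun n _ => ?_
        have h1 := h.outRate_add_inRate_le_one n c
        split_ifs with hn
        · have hin : inRate ν n c = 0 :=
            Finset.sum_eq_zero fun j _ => by rw [hn]; exact h.no_loop_back j c
          have hout : (outRate ν n c : ℝ) ≤ 1 := by
            exact_mod_cast (by omega : outRate ν n c ≤ 1)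
          have hadm : admittedAt net ν n c = admitted ν c := by simp [admittedAt, hn]
          rw [hin, hadm, zero_add]
          exact add_le_add (pow_le_one₀ (Nat.cast_nonneg _) hout)
            (pow_le_pow_left₀ (Nat.cast_nonneg _) (h.admitted_le c) 2)
        · have hadm : admittedAt net ν n c = 0 := by simp [admittedAt, hn]
          rw [hadm]
          have h2 : outRate ν n c ^ 2 + (inRate ν n c + 0) ^ 2 ≤ 1 := by
            have ho : outRate ν n c ≤ 1 := by omega
            interval_cases hh : outRate ν n c
            · have : inRate ν n c ≤ 1 := by omega
              interval_cases inRate ν n c <;> simp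
            · have : inRate ν n c = 0 := by omega
              simp [this]
          rw [add_zero]
          exact_mod_cast h2
    _ = Fintype.card Node + μM ^ 2 := by simp [Finset.sum_add_distrib]

lemma IsALG.sum_sq_backlog_succ_le (h : IsALG net μM qM V a ρ μ U R Us X Z) (t : ℕ)
    (c : Flow) (ω : Ω) :
    ∑ n, (U (t + 1) n c ω : ℝ) ^ 2 ≤ ∑ n, (U t n c ω : ℝ) ^ 2 + (Fintype.card Node + μM ^ 2)
      - 2 * ∑ n, (U t n c ω : ℝ) * ((outRate (μ t ω) n c : ℝ) - (inRate (μ t ω) n c : ℝ)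
        - (admittedAt net (μ t ω) n c : ℝ)) := by
  have hsq := (h.feasible t ω).sum_sq_rates_le c
  have hn : ∀ n, (U (t + 1) n c ω : ℝ) ^ 2 ≤ (U t n c ω : ℝ) ^ 2 +
      ((outRate (μ t ω) n c : ℝ) ^ 2 +
        ((inRate (μ t ω) n c + admittedAt net (μ t ω) n c : ℕ) : ℝ) ^ 2)
      - 2 * ((U t n c ω : ℝ) * ((outRate (μ t ω) n c : ℝ) - (inRate (μ t ω) n c : ℝ)
        - (admittedAt net (μ t ω) n c : ℝ))) := by
    intro n
    by_cases hn : n = net.dst c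
    · subst hn
      rw [h.U_dest, h.U_dest]
      simp only [Nat.cast_zero, zero_mul, mul_zero, sub_zero, ne_eq, OfNat.ofNat_ne_zero,
        not_false_eq_true, zero_pow, zero_add]
      positivity
    · have hstep : (U (t + 1) n c ω : ℝ) ≤
          max ((U t n c ω : ℝ) - (outRate (μ t ω) n c : ℝ)) 0 +
            ((inRate (μ t ω) n c + admittedAt net (μ t ω) n c : ℕ) : ℝ) := by
        have h1 : (U (t + 1) n c ω : ℝ) ≤ ((U t n c ω - outRate (μ t ω) n c : ℕ) : ℝ) +
            ((inRate (μ t ω) n c + admittedAt net (μ t ω) n c : ℕ) : ℝ) := by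
          exact_mod_cast h.U_step t n c ω hn
        refine h1.trans (add_le_add_left ?_ _)
        rcases le_total (outRate (μ t ω) n c) (U t n c ω) with hle | hle
        · rw [Nat.cast_sub hle]
          exact le_max_left _ _
        · rw [Nat.sub_eq_zero_of_le hle, Nat.cast_zero]
          exact le_max_right _ _
      have := sq_le_of_le_max_add (Nat.cast_nonneg _) (Nat.cast_nonneg _) (Nat.cast_nonneg _)
        (Nat.cast_nonneg _) hstep
      push_cast at this ⊢
      linarith
  have hsum := Finset.sum_le_sum fun n (_ : n ∈ Finset.univ) => hn n
  rw [Finset.sum_sub_distrib, Finset.sum_add_distrib, ← Finset.mul_sum] at hsum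
  linarith

/-- The part of the drift that is caused by a single flow. -/
lemma IsALG.flow_drift_le (h : IsALG net μM qM V a ρ μ U R Us X Z) (hμM : 1 ≤ μM) (hq : μM < qM)
    (ha : ∀ c, 0 ≤ a c) (hρ : ∀ c, 0 ≤ ρ c) (t : ℕ) (c : Flow) (ω : Ω) :
    ((qM - μM) / qM * Us (t + 1) c ω ^ 2 + X (t + 1) c ω ^ 2 + Z (t + 1) c ω ^ 2 +
      Us (t + 1) c ω / qM * ∑ n, (U (t + 1) n c ω : ℝ) ^ 2) / 2 ≤
    ((qM - μM) / qM * Us t c ω ^ 2 + X t c ω ^ 2 + Z t c ω ^ 2 +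
      Us t c ω / qM * ∑ n, (U t n c ω : ℝ) ^ 2) / 2 +
    (1 / 2 * Fintype.card Node * qM * μM + (qM - μM) / qM * μM ^ 2 + 1 / 2 * μM ^ 2 * ρ c ^ 2 +
      1 / 2 * (Fintype.card Node : ℝ) ^ 2 * qM ^ 2 + 1 / 2 * μM ^ 2 + 1 / 2 * a c ^ 2) +
    (Us t c ω * ((Fintype.card Node + μM ^ 2) / (2 * qM)) -
      Us t c ω / qM * ((admitted (μ t ω) c : ℝ) * (qM - μM) + ∑ n, (U t n c ω : ℝ) *
        ((outRate (μ t ω) n c : ℝ) - (inRate (μ t ω) n c : ℝ)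
          - (admittedAt net (μ t ω) n c : ℝ))) +
      R t c ω * ((qM - μM) * Us t c ω / qM - X t c ω * ρ c - Z t c ω) +
      X t c ω * ∑ n, (U t n c ω : ℝ) + Z t c ω * a c) := by
  have hq0 : 0 < qM := by linarith
  have hR0 := h.R_nonneg t c ω
  have hR1 := h.R_le t c ω
  have hS0 := h.Us_nonneg t c ω
  have hX0 := h.X_nonneg t c ω
  have hZ0 := h.Z_nonneg ha t c ω
  have hκ : 0 ≤ (qM - μM) / qM := div_nonneg (by linarith) hq0.le
  have had0 : (0 : ℝ) ≤ (admitted (μ t ω) c : ℝ) := Nat.cast_nonneg _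
  have had1 := (h.feasible t ω).admitted_le c
  have hsum0 : 0 ≤ ∑ n, (U t n c ω : ℝ) := Finset.sum_nonneg fun n _ => Nat.cast_nonneg _
  have hsum1 := h.sum_backlog_le hq0 t c ω
  have hRsq : R t c ω ^ 2 ≤ μM ^ 2 := pow_le_pow_left₀ hR0 hR1 2
  have hSd := sq_le_of_le_max_add (h.Us_nonneg (t + 1) c ω) hS0 had0 hR0 (h.Us_step t c ω).le
  have hXd := sq_le_of_le_max_add (h.X_nonneg (t + 1) c ω) hX0 (mul_nonneg (hρ c) hR0) hsum0
    (h.X_step t c ω).le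
  have hZd := sq_le_of_le_max_add (h.Z_nonneg ha (t + 1) c ω) hZ0 hR0 (ha c) (h.Z_step t c ω).le
  have hUd := h.sum_sq_backlog_succ_le t c ω
  set D := ∑ n, (U t n c ω : ℝ) * ((outRate (μ t ω) n c : ℝ) - (inRate (μ t ω) n c : ℝ)
        - (admittedAt net (μ t ω) n c : ℝ))
  have hSκ : (qM - μM) / qM * Us (t + 1) c ω ^ 2 ≤ (qM - μM) / qM * (Us t c ω ^ 2 + 2 * μM ^ 2 -
      2 * (Us t c ω * ((admitted (μ t ω) c : ℝ) - R t c ω))) := by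
    refine mul_le_mul_of_nonneg_left ?_ hκ
    have : (admitted (μ t ω) c : ℝ) ^ 2 ≤ μM ^ 2 := pow_le_pow_left₀ had0 had1 2
    linarith
  have hXsq : (ρ c * R t c ω) ^ 2 ≤ μM ^ 2 * ρ c ^ 2 := by
    rw [mul_pow, mul_comm]
    exact mul_le_mul_of_nonneg_right hRsq (sq_nonneg _)
  have hUsq : (∑ n, (U t n c ω : ℝ)) ^ 2 ≤ (Fintype.card Node : ℝ) ^ 2 * qM ^ 2 := by
    rw [← mul_pow]
    exact pow_le_pow_left₀ hsum0 hsum1 2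
  have hU'0 : 0 ≤ ∑ n, (U (t + 1) n c ω : ℝ) ^ 2 := Finset.sum_nonneg fun n _ => sq_nonneg _
  have hU'1 : ∑ n, (U (t + 1) n c ω : ℝ) ^ 2 ≤ Fintype.card Node * qM ^ 2 := by
    calc _ ≤ ∑ _n : Node, qM ^ 2 := Finset.sum_le_sum fun n _ =>
          pow_le_pow_left₀ (Nat.cast_nonneg _) (h.backlog_le hq0 (t + 1) n c ω) 2
      _ = _ := by simp
  have hS' : Us (t + 1) c ω ≤ Us t c ω + R t c ω := by
    rw [h.Us_step]
    exact add_le_add_left (max_le (by linarith) hS0) _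
  -- The increase of `Us` by at most `R ≤ μM` meets squared backlogs of total at most `N * qM ^ 2`,
  -- a constant cost. The old value of `Us` multiplies the ordinary quadratic drift of the backlogs.
  have hprod : Us (t + 1) c ω / qM * ∑ n, (U (t + 1) n c ω : ℝ) ^ 2 ≤
      Fintype.card Node * qM * μM + Us t c ω / qM *
        (∑ n, (U t n c ω : ℝ) ^ 2 + (Fintype.card Node + μM ^ 2) - 2 * D) := by
    calc Us (t + 1) c ω / qM * ∑ n, (U (t + 1) n c ω : ℝ) ^ 2
        ≤ (Us t c ω + R t c ω) / qM * ∑ n, (U (t + 1) n c ω : ℝ) ^ 2 :=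
          mul_le_mul_of_nonneg_right (div_le_div_of_nonneg_right hS' hq0.le) hU'0
      _ = R t c ω / qM * ∑ n, (U (t + 1) n c ω : ℝ) ^ 2 +
          Us t c ω / qM * ∑ n, (U (t + 1) n c ω : ℝ) ^ 2 := by ring
      _ ≤ μM / qM * (Fintype.card Node * qM ^ 2) + Us t c ω / qM *
          (∑ n, (U t n c ω : ℝ) ^ 2 + (Fintype.card Node + μM ^ 2) - 2 * D) := by
          refine add_le_add (mul_le_mul (div_le_div_of_nonneg_right hR1 hq0.le) hU'1 hU'0
            (div_nonneg (by linarith) hq0.le)) (mul_le_mul_of_nonneg_left hUd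
            (div_nonneg hS0 hq0.le))
      _ = _ := by field_simp
  have e1 : Us t c ω * ((Fintype.card Node + μM ^ 2) / (2 * qM)) =
      Us t c ω / qM * (Fintype.card Node + μM ^ 2) / 2 := by field_simp
  rw [e1]
  have e2 : (qM - μM) * Us t c ω / qM = (qM - μM) / qM * Us t c ω := by ring
  have e3 : Us t c ω / qM * ((admitted (μ t ω) c : ℝ) * (qM - μM) + D) =
      (qM - μM) / qM * (Us t c ω * (admitted (μ t ω) c : ℝ)) + Us t c ω / qM * D := by ring
  rw [e2, e3]
  linarith

/-- Max-weight contributes `-Us * (qM - μM) / qM * (r + ε)`, and replacing `R` by `r` in the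
congestion objective contributes `+Us * (qM - μM) / qM * r`; only the slack `ε` remains. The
parameter `δ` is bounded only from above, so that `δ = 0` is allowed. -/
lemma IsALG.lyapunov_succ_le (h : IsALG net μM qM V a ρ μ U R Us X Z) (hμM : 1 ≤ μM)
    (hq : μM < qM) (ha : ∀ c, 0 ≤ a c) (hρ : ∀ c, 0 ≤ ρ c) {r : Flow → ℝ} {ε δ : ℝ} (hε : 0 ≤ ε)
    (hr : (fun c => r c + ε) ∈ capacityRegion net μM) (hr0 : ∀ c, 0 ≤ r c)
    (hδS : δ ≤ (ε * (qM - μM) - (2 * (Fintype.card Node : ℝ) - 1 + μM ^ 2) / 2) / qM)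
    (hδX : ∀ c, δ ≤ ρ c * r c - (Fintype.card Node : ℝ) * qM) (hδZ : ∀ c, δ ≤ r c - a c)
    (t : ℕ) (ω : Ω) :
    lyapunov μM qM (fun n c => U (t + 1) n c ω) (fun c => Us (t + 1) c ω) (fun c => X (t + 1) c ω)
        (fun c => Z (t + 1) c ω) ≤
      lyapunov μM qM (fun n c => U t n c ω) (fun c => Us t c ω) (fun c => X t c ω)
        (fun c => Z t c ω) + constB Node μM qM a ρ + V * ∑ c, R t c ω - V * ∑ c, r c -
      δ * ∑ c, (Us t c ω + X t c ω + Z t c ω) := by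
  have hq0 : 0 < qM := by linarith
  have hmw := (h.scheduling t ω).sum_mul_le_of_mem_capacityRegion (by linarith) hr hq0
    (fun c => h.Us_nonneg t c ω) (fun n c => h.backlog_le hq0 t n c ω) (fun c => h.U_dest t c ω)
  rw [(h.feasible t ω).sum_mul_weight] at hmw
  have hflow := Finset.sum_le_sum fun c (_ : c ∈ Finset.univ) =>
    h.flow_drift_le hμM hq ha hρ t c ω
  rw [Finset.sum_add_distrib, Finset.sum_add_distrib] at hflow
  have hB : ∑ c, (1 / 2 * Fintype.card Node * qM * μM + (qM - μM) / qM * μM ^ 2 +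
      1 / 2 * μM ^ 2 * ρ c ^ 2 + 1 / 2 * (Fintype.card Node : ℝ) ^ 2 * qM ^ 2 + 1 / 2 * μM ^ 2 +
      1 / 2 * a c ^ 2) ≤ constB Node μM qM a ρ := by
    -- The drift needs only `∑ c, a c ^ 2`; `constB` carries an additional factor `K`, harmless also
    -- when there are no flows.
    have hK : ∑ c, a c ^ 2 ≤ (Fintype.card Flow : ℝ) * ∑ c, a c ^ 2 := by
      rcases isEmpty_or_nonempty Flow with hF | hF
      · simp
      · exact le_mul_of_one_le_left (Finset.sum_nonneg fun c _ => sq_nonneg _)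
          (by exact_mod_cast Fintype.card_pos)
    simp only [Finset.sum_add_distrib, ← Finset.mul_sum, Finset.sum_const, Finset.card_univ,
      nsmul_eq_mul]
    unfold constB
    nlinarith
  have hrest : ∑ c, (Us t c ω * ((Fintype.card Node + μM ^ 2) / (2 * qM)) -
      Us t c ω / qM * ((admitted (μ t ω) c : ℝ) * (qM - μM) + ∑ n, (U t n c ω : ℝ) *
        ((outRate (μ t ω) n c : ℝ) - (inRate (μ t ω) n c : ℝ)
          - (admittedAt net (μ t ω) n c : ℝ))) +
      R t c ω * ((qM - μM) * Us t c ω / qM - X t c ω * ρ c - Z t c ω) +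
      X t c ω * ∑ n, (U t n c ω : ℝ) + Z t c ω * a c) ≤
      ∑ c, (Us t c ω * ((Fintype.card Node + μM ^ 2) / (2 * qM)) -
        Us t c ω * ((qM - μM) / qM) * (r c + ε) +
      R t c ω * ((qM - μM) * Us t c ω / qM - X t c ω * ρ c - Z t c ω) +
      X t c ω * ∑ n, (U t n c ω : ℝ) + Z t c ω * a c) := by
    simp only [Finset.sum_add_distrib, Finset.sum_sub_distrib] at hmw ⊢
    linarith
  have hflow2 : ∀ c, Us t c ω * ((Fintype.card Node + μM ^ 2) / (2 * qM)) -
        Us t c ω * ((qM - μM) / qM) * (r c + ε) +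
      R t c ω * ((qM - μM) * Us t c ω / qM - X t c ω * ρ c - Z t c ω) +
      X t c ω * ∑ n, (U t n c ω : ℝ) + Z t c ω * a c ≤
      V * R t c ω - V * r c - δ * (Us t c ω + X t c ω + Z t c ω) := by
    intro c
    have hrμ : r c ≤ μM := by
      have := le_of_mem_capacityRegion (by linarith) hr c
      linarith
    have hcong := (h.congestion t c ω).2 (r c) (hr0 c) hrμ
    have hS0 := h.Us_nonneg t c ω
    have hX0 := h.X_nonneg t c ω
    have hZ0 := h.Z_nonneg ha t c ω
    -- The drift produces `N + μM ^ 2`, which is at most the `2 * N - 1 + μM ^ 2` of the size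
    -- condition as soon as there is a node.
    have hN : (1 : ℝ) ≤ Fintype.card Node := by
      have : Nonempty Node := ⟨net.src c⟩
      exact_mod_cast Fintype.card_pos (α := Node)
    have hcoef : δ ≤ ε * ((qM - μM) / qM) - (Fintype.card Node + μM ^ 2) / (2 * qM) := by
      refine hδS.trans ?_
      have e : ε * ((qM - μM) / qM) - (Fintype.card Node + μM ^ 2) / (2 * qM) =
        (ε * (qM - μM) - (Fintype.card Node + μM ^ 2) / 2) / qM := by field_simp
      rw [e]
      exact div_le_div_of_nonneg_right (by linarith) hq0.le
    have h1 := mul_le_mul_of_nonneg_left hcoef hS0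
    have h2 := mul_le_mul_of_nonneg_left (hδX c) hX0
    have h3 := mul_le_mul_of_nonneg_left (hδZ c) hZ0
    have h4 := mul_le_mul_of_nonneg_left (h.sum_backlog_le hq0 t c ω) hX0
    have e2 : (qM - μM) * Us t c ω / qM = (qM - μM) / qM * Us t c ω := by ring
    rw [e2] at hcong ⊢
    nlinarith
  have hsum2 := Finset.sum_le_sum fun c (_ : c ∈ Finset.univ) => hflow2 c
  rw [Finset.sum_sub_distrib, Finset.sum_sub_distrib, ← Finset.mul_sum, ← Finset.mul_sum,
    ← Finset.mul_sum] at hsum2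
  unfold lyapunov
  linarith

lemma lyapunov_nonneg (hq : μM ≤ qM) (hq0 : 0 ≤ qM) (u : Node → Flow → ℕ) {S : Flow → ℝ}
    (hS : ∀ c, 0 ≤ S c) (X Z : Flow → ℝ) : 0 ≤ lyapunov μM qM u S X Z := by
  refine Finset.sum_nonneg fun c _ => ?_
  have h1 : 0 ≤ (qM - μM) / qM := div_nonneg (by linarith) hq0
  have h2 : 0 ≤ S c / qM := div_nonneg (hS c) hq0
  have h3 : 0 ≤ ∑ n, (u n c : ℝ) ^ 2 := Finset.sum_nonneg fun n _ => sq_nonneg _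
  positivity

lemma le_two_mul_lyapunov (hq : μM ≤ qM) (hq0 : 0 ≤ qM) (u : Node → Flow → ℕ) {S : Flow → ℝ}
    (hS : ∀ c, 0 ≤ S c) (X Z : Flow → ℝ) (c : Flow) :
    (qM - μM) / qM * S c ^ 2 + X c ^ 2 ≤ 2 * lyapunov μM qM u S X Z := by
  have h1 : 0 ≤ (qM - μM) / qM := div_nonneg (by linarith) hq0
  have h3 : ∀ c, 0 ≤ ∑ n, (u n c : ℝ) ^ 2 := fun c => Finset.sum_nonneg fun n _ => sq_nonneg _
  have hle : ((qM - μM) / qM * S c ^ 2 + X c ^ 2 + Z c ^ 2 + S c / qM * ∑ n, (u n c : ℝ) ^ 2) / 2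
      ≤ lyapunov μM qM u S X Z :=
    Finset.single_le_sum (f := fun c => ((qM - μM) / qM * S c ^ 2 + X c ^ 2 + Z c ^ 2 +
      S c / qM * ∑ n, (u n c : ℝ) ^ 2) / 2) (fun c _ => by
        have h2 : 0 ≤ S c / qM := div_nonneg (hS c) hq0
        have := h3 c
        positivity) (Finset.mem_univ c)
  have h4 : 0 ≤ S c / qM * ∑ n, (u n c : ℝ) ^ 2 := mul_nonneg (div_nonneg (hS c) hq0) (h3 c)
  nlinarith [sq_nonneg (Z c)]

/-- The one-slot bound holds for every `ω`, so it is summed path by path, with no conditional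
expectations; all queues start at zero. -/
lemma IsALG.lyapunov_le (h : IsALG net μM qM V a ρ μ U R Us X Z) (hμM : 1 ≤ μM)
    (hq : μM < qM) (ha : ∀ c, 0 ≤ a c) (hρ : ∀ c, 0 ≤ ρ c) {r : Flow → ℝ} {ε δ : ℝ} (hε : 0 ≤ ε)
    (hr : (fun c => r c + ε) ∈ capacityRegion net μM) (hr0 : ∀ c, 0 ≤ r c)
    (hδS : δ ≤ (ε * (qM - μM) - (2 * (Fintype.card Node : ℝ) - 1 + μM ^ 2) / 2) / qM)
    (hδX : ∀ c, δ ≤ ρ c * r c - (Fintype.card Node : ℝ) * qM) (hδZ : ∀ c, δ ≤ r c - a c)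
    (t : ℕ) (ω : Ω) :
    lyapunov μM qM (fun n c => U t n c ω) (fun c => Us t c ω) (fun c => X t c ω)
        (fun c => Z t c ω) ≤
      t * (constB Node μM qM a ρ - V * ∑ c, r c) + V * ∑ τ ∈ Finset.range t, ∑ c, R τ c ω -
      δ * ∑ τ ∈ Finset.range t, ∑ c, (Us τ c ω + X τ c ω + Z τ c ω) := by
  induction t with
  | zero => simp [lyapunov, h.Us_init, h.X_init, h.Z_init]
  | succ t ih =>
    have := h.lyapunov_succ_le hμM hq ha hρ hε hr hr0 hδS hδX hδZ t ω
    rw [Finset.sum_range_succ, Finset.sum_range_succ]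
    push_cast
    linarith

/-! ### Virtual queues and the rates they control -/

/-- Replacing `max x 0` by `x` only lowers the queue. Thus a sublinear queue forces admissions to
keep up with `R` on average. -/
lemma IsALG.sum_sub_admitted_le (h : IsALG net μM qM V a ρ μ U R Us X Z) (t : ℕ) (c : Flow)
    (ω : Ω) : ∑ τ ∈ Finset.range t, (R τ c ω - (admitted (μ τ ω) c : ℝ)) ≤ Us t c ω := by
  induction t with
  | zero => simp [h.Us_init]
  | succ t ih =>
    rw [Finset.sum_range_succ, h.Us_step]
    linarith [le_max_left (Us t c ω - (admitted (μ t ω) c : ℝ)) 0]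

lemma IsALG.sum_backlog_sub_le (h : IsALG net μM qM V a ρ μ U R Us X Z) (t : ℕ) (c : Flow)
    (ω : Ω) : ∑ τ ∈ Finset.range t, (∑ n, (U τ n c ω : ℝ) - ρ c * R τ c ω) ≤ X t c ω := by
  induction t with
  | zero => simp [h.X_init]
  | succ t ih =>
    rw [Finset.sum_range_succ, h.X_step]
    linarith [le_max_left (X t c ω - ρ c * R t c ω) 0]

/-! ### Integrability -/

lemma IsALG.integrable_R (h : IsALG net μM qM V a ρ μ U R Us X Z) (P : Measure Ω)
    [IsProbabilityMeasure P] (t : ℕ) (c : Flow) : Integrable (R t c) P := by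
  refine Integrable.of_bound (h.measurable_R t c).aestronglyMeasurable μM
    (Eventually.of_forall fun ω => ?_)
  rw [Real.norm_of_nonneg (h.R_nonneg t c ω)]
  exact h.R_le t c ω

lemma IsALG.integrable_admitted (h : IsALG net μM qM V a ρ μ U R Us X Z) (P : Measure Ω)
    [IsProbabilityMeasure P] (t : ℕ) (c : Flow) :
    Integrable (fun ω => (admitted (μ t ω) c : ℝ)) P := by
  refine Integrable.of_bound (measurable_from_top.comp
    (h.measurable_rates t (Sum.inr c) c)).aestronglyMeasurable μM (Eventually.of_forall fun ω => ?_)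
  rw [Real.norm_of_nonneg (Nat.cast_nonneg _)]
  exact (h.feasible t ω).admitted_le c

lemma IsALG.integrable_Us (h : IsALG net μM qM V a ρ μ U R Us X Z) (P : Measure Ω)
    [IsProbabilityMeasure P] (t : ℕ) (c : Flow) : Integrable (Us t c) P := by
  refine Integrable.of_bound (h.measurable_Us t c).aestronglyMeasurable (t * μM)
    (Eventually.of_forall fun ω => ?_)
  rw [Real.norm_of_nonneg (h.Us_nonneg t c ω)]
  induction t with
  | zero => simp [h.Us_init]
  | succ t ih =>
    rw [h.Us_step]
    have h1 : max (Us t c ω - (admitted (μ t ω) c : ℝ)) 0 ≤ Us t c ω :=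
      max_le (sub_le_self _ (Nat.cast_nonneg _)) (h.Us_nonneg t c ω)
    have := h.R_le t c ω
    push_cast
    linarith

lemma IsALG.integrable_X (h : IsALG net μM qM V a ρ μ U R Us X Z) (hq : 0 < qM)
    (hρ : ∀ c, 0 ≤ ρ c) (P : Measure Ω) [IsProbabilityMeasure P] (t : ℕ) (c : Flow) :
    Integrable (X t c) P := by
  refine Integrable.of_bound (h.measurable_X t c).aestronglyMeasurable
    (t * (Fintype.card Node * qM)) (Eventually.of_forall fun ω => ?_)
  rw [Real.norm_of_nonneg (h.X_nonneg t c ω)]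
  induction t with
  | zero => simp [h.X_init]
  | succ t ih =>
    rw [h.X_step]
    have h1 : max (X t c ω - ρ c * R t c ω) 0 ≤ X t c ω :=
      max_le (sub_le_self _ (mul_nonneg (hρ c) (h.R_nonneg t c ω))) (h.X_nonneg t c ω)
    have := h.sum_backlog_le hq t c ω
    push_cast
    linarith

lemma IsALG.integrable_Z (h : IsALG net μM qM V a ρ μ U R Us X Z) (ha : ∀ c, 0 ≤ a c)
    (P : Measure Ω) [IsProbabilityMeasure P] (t : ℕ) (c : Flow) : Integrable (Z t c) P := by
  refine Integrable.of_bound (h.measurable_Z t c).aestronglyMeasurable (t * a c)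
    (Eventually.of_forall fun ω => ?_)
  rw [Real.norm_of_nonneg (h.Z_nonneg ha t c ω)]
  induction t with
  | zero => simp [h.Z_init]
  | succ t ih =>
    rw [h.Z_step]
    have h1 : max (Z t c ω - R t c ω) 0 ≤ Z t c ω :=
      max_le (sub_le_self _ (h.R_nonneg t c ω)) (h.Z_nonneg ha t c ω)
    push_cast
    linarith

end ALG

/-! ### Limits of time averages -/

lemma tendsto_const_mul_sqrt_div_atTop (C : ℝ) :
    Tendsto (fun t : ℕ => C * √(t : ℝ) / t) atTop (𝓝 0) := by
  have h : Tendsto (fun t : ℕ => C / √(t : ℝ)) atTop (𝓝 0) :=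
    (Real.tendsto_sqrt_atTop.comp tendsto_natCast_atTop_atTop).const_div_atTop C
  refine h.congr fun t => ?_
  rw [mul_div_assoc, Real.sqrt_div_self, ← div_eq_mul_inv]

lemma limsupAvg_le_of_eventually {f e : ℕ → ℝ} {b : ℝ} (he : Tendsto e atTop (𝓝 0))
    (h : ∀ᶠ t in atTop, timeAvg f t ≤ b + e t) : limsupAvg f ≤ (b : EReal) := by
  have ht : Tendsto (fun t => ((b + e t : ℝ) : EReal)) atTop (𝓝 (b : EReal)) := by
    refine (continuous_coe_real_ereal.tendsto b).comp ?_
    simpa using he.const_add b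
  rw [← ht.limsup_eq]
  exact limsup_le_limsup (h.mono fun t ht => EReal.coe_le_coe_iff.mpr ht)

lemma le_liminfAvg_of_eventually {f e : ℕ → ℝ} {b : ℝ} (he : Tendsto e atTop (𝓝 0))
    (h : ∀ᶠ t in atTop, b - e t ≤ timeAvg f t) : (b : EReal) ≤ liminfAvg f := by
  have ht : Tendsto (fun t => ((b - e t : ℝ) : EReal)) atTop (𝓝 (b : EReal)) := by
    refine (continuous_coe_real_ereal.tendsto b).comp ?_
    simpa using he.const_sub b
  rw [← ht.liminf_eq]
  exact liminf_le_liminf (h.mono fun t ht => EReal.coe_le_coe_iff.mpr ht)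

lemma eventually_timeAvg_le_of_limsupAvg_le {f : ℕ → ℝ} {b η : ℝ} (hη : 0 < η)
    (h : limsupAvg f ≤ (b : EReal)) : ∀ᶠ t in atTop, timeAvg f t ≤ b + η := by
  have hlt : limsupAvg f < ((b + η : ℝ) : EReal) :=
    h.trans_lt (EReal.coe_lt_coe_iff.mpr (lt_add_of_pos_right b hη))
  exact (eventually_lt_of_limsup_lt hlt).mono fun t ht => (EReal.coe_lt_coe_iff.mp ht).le

lemma limsupAvg_le_div_of_mul_timeAvg_le {f g : ℕ → ℝ} {A V b δ : ℝ} (hV : 0 < V) (hδ : 0 < δ)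
    (hg : limsupAvg g ≤ (b : EReal))
    (h : ∀ᶠ t in atTop, δ * timeAvg f t ≤ A + V * timeAvg g t) :
    limsupAvg f ≤ ((A + V * b) / δ : ℝ) := by
  refine EReal.le_of_forall_lt_iff_le.mp fun x hx => ?_
  have hx' : (A + V * b) / δ < x := EReal.coe_lt_coe_iff.mp hx
  rw [div_lt_iff₀ hδ] at hx'
  -- This tolerance above the limsup of `g` solves `A + V * (b + η) = x * δ`.
  have hη : 0 < (x * δ - (A + V * b)) / V := div_pos (by linarith) hV
  refine limsupAvg_le_of_eventually (e := fun _ => 0) tendsto_const_nhds ?_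
  filter_upwards [h, eventually_timeAvg_le_of_limsupAvg_le hη hg] with t h1 h2
  have h3 := mul_le_mul_of_nonneg_left h2 hV.le
  rw [mul_add, mul_div_cancel₀ _ hV.ne'] at h3
  rw [add_zero]
  refine le_of_mul_le_mul_left ?_ hδ
  linarith

section Expectation

variable {Ω ι : Type*} [MeasurableSpace Ω] {P : Measure Ω} [Fintype ι] {f : ℕ → ι → Ω → ℝ}

lemma integrable_timeAvg_sum (hf : ∀ τ i, Integrable (f τ i) P) (t : ℕ) :
    Integrable (fun ω => timeAvg (fun τ => ∑ i, f τ i ω) t) P :=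
  (integrable_finsetSum _ fun τ _ => integrable_finsetSum _ fun i _ => hf τ i).div_const _

lemma timeAvg_sum_integral (hf : ∀ τ i, Integrable (f τ i) P) (t : ℕ) :
    timeAvg (fun τ => ∑ i, ∫ ω, f τ i ω ∂P) t =
      ∫ ω, timeAvg (fun τ => ∑ i, f τ i ω) t ∂P := by
  unfold timeAvg
  rw [integral_div, integral_finsetSum _ fun τ _ => integrable_finsetSum _ fun i _ => hf τ i]
  congr 1
  exact Finset.sum_congr rfl fun τ _ => (integral_finsetSum _ fun i _ => hf τ i).symm

lemma le_timeAvg_sum_integral [IsProbabilityMeasure P] (hf : ∀ τ i, Integrable (f τ i) P) {t : ℕ}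
    {b : ℝ} (h : ∀ ω, b ≤ timeAvg (fun τ => ∑ i, f τ i ω) t) :
    b ≤ timeAvg (fun τ => ∑ i, ∫ ω, f τ i ω ∂P) t := by
  rw [timeAvg_sum_integral hf]
  calc b = ∫ _ω, b ∂P := by simp
    _ ≤ _ := integral_mono (integrable_const b) (integrable_timeAvg_sum hf t) h

end Expectation

/-! ### Time averages under ALG -/

section ALG

variable {net : Network Node Flow} {μM qM V : ℝ} {a ρ : Flow → ℝ} {Ω : Type*} [MeasurableSpace Ω]
  {μ : ℕ → Ω → Rates Node Flow} {U : ℕ → Node → Flow → Ω → ℕ} {R Us X Z : ℕ → Flow → Ω → ℝ}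
  {r : Flow → ℝ} {ε : ℝ}

/-- The size condition leaves room for a nonnegative drift parameter. -/
lemma SizeCondition.nonneg_slack (hμM : 1 ≤ μM) (hε : 0 < ε) (hr : ∀ c, 0 < r c)
    (hs : SizeCondition Node μM ε r qM ρ) :
    μM < qM ∧ (∀ c, 0 ≤ ρ c) ∧
      0 ≤ (ε * (qM - μM) - (2 * (Fintype.card Node : ℝ) - 1 + μM ^ 2) / 2) / qM ∧
      ∀ c, 0 ≤ ρ c * r c - (Fintype.card Node : ℝ) * qM := by
  obtain ⟨h1, h2⟩ := hs
  have hN : (0 : ℝ) ≤ Fintype.card Node := Nat.cast_nonneg _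
  have hnum : 0 ≤ 2 * (Fintype.card Node : ℝ) - 1 + μM ^ 2 := by nlinarith
  have hq : μM < qM := lt_of_le_of_lt (le_add_of_nonneg_left (div_nonneg hnum (by linarith))) h1
  have hq0 : 0 ≤ qM := by linarith
  refine ⟨hq, fun c => ?_, div_nonneg ?_ hq0, fun c => ?_⟩
  · exact (div_nonneg (mul_nonneg hN hq0) (hr c).le).trans (h2 c).le
  · have h3 := lt_sub_iff_add_lt.mpr h1
    rw [div_lt_iff₀ (by linarith)] at h3
    linarith
  · have h3 := h2 c
    rw [div_lt_iff₀ (hr c)] at h3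
    linarith

/-- The virtual queues grow at most like the square root of time. -/
lemma IsALG.exists_queue_le_sqrt (h : IsALG net μM qM V a ρ μ U R Us X Z) (hμM : 1 ≤ μM)
    (hV : 0 ≤ V) (ha : ∀ c, 0 ≤ a c) (hε : 0 < ε) (hr : ∀ c, 0 < r c) (har : ∀ c, a c ≤ r c)
    (hmem : (fun c => r c + ε) ∈ capacityRegion net μM) (hs : SizeCondition Node μM ε r qM ρ) :
    ∃ C : ℝ, ∀ t c ω, Us t c ω ≤ C * √(t : ℝ) ∧ X t c ω ≤ C * √(t : ℝ) := by
  obtain ⟨hq, hρ, hsS, hsX⟩ := hs.nonneg_slack hμM hε hr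
  have hq0 : 0 < qM := by linarith
  have hκ : 0 < (qM - μM) / qM := div_pos (by linarith) hq0
  have hκ1 : (qM - μM) / qM ≤ 1 := (div_le_one hq0).mpr (by linarith)
  -- With `δ = 0` and `R ≤ μM` the Lyapunov function is at most `(B + V * K * μM) * t`. Dividing by
  -- the coefficient `(qM - μM) / qM` of `Us ^ 2` serves `X` too, since this coefficient is at most
  -- `1`.
  refine ⟨√(2 * (constB Node μM qM a ρ + V * (Fintype.card Flow * μM)) / ((qM - μM) / qM)),
    fun t c ω => ?_⟩
  have hL := h.lyapunov_le hμM hq ha hρ hε.le hmem (fun c => (hr c).le) hsS hsX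
    (fun c => sub_nonneg.mpr (har c)) t ω
  have hR : ∑ τ ∈ Finset.range t, ∑ c, R τ c ω ≤ t * (Fintype.card Flow * μM) := by
    calc _ ≤ ∑ _τ ∈ Finset.range t, ∑ _c : Flow, μM :=
          Finset.sum_le_sum fun τ _ => Finset.sum_le_sum fun c _ => h.R_le τ c ω
      _ = _ := by simp
  have hrs : 0 ≤ t * (V * ∑ c, r c) :=
    mul_nonneg (Nat.cast_nonneg t) (mul_nonneg hV (Finset.sum_nonneg fun c _ => (hr c).le))
  have hVR := mul_le_mul_of_nonneg_left hR hV
  have h2L := le_two_mul_lyapunov hq.le hq0.le (fun n c => U t n c ω)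
    (fun c => h.Us_nonneg t c ω) (fun c => X t c ω) (fun c => Z t c ω) c
  have hbound : (qM - μM) / qM * Us t c ω ^ 2 + X t c ω ^ 2 ≤
      2 * (constB Node μM qM a ρ + V * (Fintype.card Flow * μM)) * t := by
    linarith
  have hX2 : (qM - μM) / qM * X t c ω ^ 2 ≤ X t c ω ^ 2 :=
    mul_le_of_le_one_left (sq_nonneg _) hκ1
  have hS2 : 0 ≤ (qM - μM) / qM * Us t c ω ^ 2 := mul_nonneg hκ.le (sq_nonneg _)
  rw [← Real.sqrt_mul' _ (Nat.cast_nonneg t)]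
  constructor <;> refine Real.le_sqrt_of_sq_le ?_ <;>
    rw [div_mul_eq_mul_div, le_div_iff₀ hκ] <;> nlinarith [sq_nonneg (X t c ω)]

/-- Pathwise trade-off between throughput and virtual queues. -/
lemma IsALG.mul_timeAvg_queues_le (h : IsALG net μM qM V a ρ μ U R Us X Z) (hμM : 1 ≤ μM)
    (hq : μM < qM) (ha : ∀ c, 0 ≤ a c) (hρ : ∀ c, 0 ≤ ρ c) {δ : ℝ} (hε : 0 ≤ ε)
    (hr : (fun c => r c + ε) ∈ capacityRegion net μM) (hr0 : ∀ c, 0 ≤ r c)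
    (hδS : δ ≤ (ε * (qM - μM) - (2 * (Fintype.card Node : ℝ) - 1 + μM ^ 2) / 2) / qM)
    (hδX : ∀ c, δ ≤ ρ c * r c - (Fintype.card Node : ℝ) * qM) (hδZ : ∀ c, δ ≤ r c - a c)
    {t : ℕ} (ht : 0 < t) (ω : Ω) :
    δ * timeAvg (fun τ => ∑ c, (Us τ c ω + X τ c ω + Z τ c ω)) t ≤
      constB Node μM qM a ρ - V * ∑ c, r c + V * timeAvg (fun τ => ∑ c, R τ c ω) t := by
  have hL := h.lyapunov_le hμM hq ha hρ hε hr hr0 hδS hδX hδZ t ω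
  have hL0 := lyapunov_nonneg hq.le (by linarith) (fun n c => U t n c ω)
    (fun c => h.Us_nonneg t c ω) (fun c => X t c ω) (fun c => Z t c ω)
  have ht' : (0 : ℝ) < t := by exact_mod_cast ht
  unfold timeAvg
  rw [mul_div_assoc', mul_div_assoc', div_le_iff₀ ht', add_mul, div_mul_cancel₀ _ ht'.ne']
  linarith

lemma IsALG.le_timeAvg_R (h : IsALG net μM qM V a ρ μ U R Us X Z) (hμM : 1 ≤ μM)
    (hV : 0 < V) (ha : ∀ c, 0 ≤ a c) (hε : 0 < ε) (hr : ∀ c, 0 < r c) (har : ∀ c, a c ≤ r c)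
    (hmem : (fun c => r c + ε) ∈ capacityRegion net μM) (hs : SizeCondition Node μM ε r qM ρ)
    {t : ℕ} (ht : 0 < t) (ω : Ω) :
    (∑ c, r c) - constB Node μM qM a ρ / V ≤ timeAvg (fun τ => ∑ c, R τ c ω) t := by
  obtain ⟨hq, hρ, hsS, hsX⟩ := hs.nonneg_slack hμM hε hr
  -- Here `δ = 0`: the queue term disappears and only the throughput is left.
  have h1 := h.mul_timeAvg_queues_le hμM hq ha hρ hε.le hmem (fun c => (hr c).le) hsS hsX
    (fun c => sub_nonneg.mpr (har c)) ht ω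
  rw [zero_mul] at h1
  rw [sub_le_iff_le_add', ← sub_le_iff_le_add, le_div_iff₀ hV]
  linarith

lemma IsALG.timeAvg_R_sub_le (h : IsALG net μM qM V a ρ μ U R Us X Z) {C : ℝ}
    (hC : ∀ t c ω, Us t c ω ≤ C * √(t : ℝ) ∧ X t c ω ≤ C * √(t : ℝ)) (t : ℕ) (ω : Ω) :
    timeAvg (fun τ => ∑ c, R τ c ω) t - (Fintype.card Flow * C) * √(t : ℝ) / t ≤
      timeAvg (fun τ => ∑ c, (admitted (μ τ ω) c : ℝ)) t := by
  unfold timeAvg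
  rw [← sub_div]
  refine div_le_div_of_nonneg_right ?_ (Nat.cast_nonneg t)
  rw [sub_le_iff_le_add', ← sub_le_iff_le_add, ← Finset.sum_sub_distrib]
  simp only [← Finset.sum_sub_distrib]
  rw [Finset.sum_comm]
  calc _ ≤ ∑ _c : Flow, C * √(t : ℝ) :=
        Finset.sum_le_sum fun c _ => (h.sum_sub_admitted_le t c ω).trans (hC t c ω).1
    _ = Fintype.card Flow * C * √(t : ℝ) := by simp [mul_assoc]

/-- `X` bounds the accumulated excess of the backlog over `ρ * R`, and `ρ * Us` that of `ρ * R` over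
`ρ` times the admissions. Their sum is at most `(C + ρ * C) * √t`, hence negligible against `t`. -/
lemma IsALG.limsupAvg_backlog_sub_le (h : IsALG net μM qM V a ρ μ U R Us X Z)
    (hρ : ∀ c, 0 ≤ ρ c) {C : ℝ}
    (hC : ∀ t c ω, Us t c ω ≤ C * √(t : ℝ) ∧ X t c ω ≤ C * √(t : ℝ)) (c : Flow) (ω : Ω) :
    limsupAvg (fun τ => (∑ n, (U τ n c ω : ℝ)) - ρ c * (admitted (μ τ ω) c : ℝ)) ≤ 0 := by
  rw [← EReal.coe_zero]
  refine limsupAvg_le_of_eventually (tendsto_const_mul_sqrt_div_atTop (C + ρ c * C))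
    (Eventually.of_forall fun t => ?_)
  rw [zero_add]
  refine div_le_div_of_nonneg_right ?_ (Nat.cast_nonneg t)
  have h1 := (h.sum_backlog_sub_le t c ω).trans (hC t c ω).2
  have h2 := mul_le_mul_of_nonneg_left ((h.sum_sub_admitted_le t c ω).trans (hC t c ω).1) (hρ c)
  rw [Finset.mul_sum] at h2
  have h3 := add_le_add h1 h2
  rw [← Finset.sum_add_distrib] at h3
  refine le_of_eq_of_le (Finset.sum_congr rfl fun τ _ => ?_) (h3.trans (le_of_eq ?_))
  · ring
  · ring

lemma IsALG.limsupAvg_R_le (h : IsALG net μM qM V a ρ μ U R Us X Z) (hμM : 0 ≤ μM)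
    (P : Measure Ω) [IsProbabilityMeasure P] :
    limsupAvg (fun τ => ∑ c, ∫ ω, R τ c ω ∂P) ≤ (((Fintype.card Flow : ℝ) * μM : ℝ) : EReal) := by
  refine limsupAvg_le_of_eventually (e := fun _ => 0) tendsto_const_nhds
    (Eventually.of_forall fun t => ?_)
  rw [add_zero]
  refine timeAvg_le_of_forall_le (by positivity) (fun τ => ?_) t
  calc ∑ c, ∫ ω, R τ c ω ∂P ≤ ∑ _c : Flow, μM := by
        refine Finset.sum_le_sum fun c _ => ?_
        calc ∫ ω, R τ c ω ∂P ≤ ∫ _ω, μM ∂P :=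
              integral_mono (h.integrable_R P τ c) (integrable_const _) fun ω => h.R_le τ c ω
          _ = μM := by simp
    _ = _ := by simp

lemma IsALG.limsupAvg_queues_le (h : IsALG net μM qM V a ρ μ U R Us X Z) (hμM : 1 ≤ μM)
    (hV : 0 < V) (hq : μM < qM) (ha : ∀ c, 0 ≤ a c) (hρ : ∀ c, 0 ≤ ρ c) {δ BR : ℝ} (hε : 0 ≤ ε)
    (hr : (fun c => r c + ε) ∈ capacityRegion net μM) (hr0 : ∀ c, 0 ≤ r c) (hδ : 0 < δ)
    (hδS : δ ≤ (ε * (qM - μM) - (2 * (Fintype.card Node : ℝ) - 1 + μM ^ 2) / 2) / qM)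
    (hδX : ∀ c, δ ≤ ρ c * r c - (Fintype.card Node : ℝ) * qM) (hδZ : ∀ c, δ ≤ r c - a c)
    (P : Measure Ω) [IsProbabilityMeasure P]
    (hBR : limsupAvg (fun τ => ∑ c, ∫ ω, R τ c ω ∂P) ≤ (BR : EReal)) :
    limsupAvg (fun τ => ∑ c, ∫ ω, (Us τ c ω + X τ c ω + Z τ c ω) ∂P) ≤
      (((constB Node μM qM a ρ + V * BR) / δ : ℝ) : EReal) := by
  have hq0 : 0 < qM := by linarith
  have hiR := h.integrable_R P
  have hiQ : ∀ τ c, Integrable (fun ω => Us τ c ω + X τ c ω + Z τ c ω) P := fun τ c =>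
    ((h.integrable_Us P τ c).add (h.integrable_X hq0 hρ P τ c)).add (h.integrable_Z ha P τ c)
  refine limsupAvg_le_div_of_mul_timeAvg_le hV hδ hBR ?_
  filter_upwards [eventually_gt_atTop 0] with t ht
  rw [timeAvg_sum_integral hiR, timeAvg_sum_integral hiQ, ← integral_const_mul,
    ← integral_const_mul]
  calc _ ≤ ∫ ω, (constB Node μM qM a ρ + V * timeAvg (fun τ => ∑ c, R τ c ω) t) ∂P := by
        refine integral_mono ((integrable_timeAvg_sum hiQ t).const_mul δ)
          ((integrable_const _).add ((integrable_timeAvg_sum hiR t).const_mul V)) fun ω => ?_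
        have h1 := h.mul_timeAvg_queues_le hμM hq ha hρ hε hr hr0 hδS hδX hδZ ht ω
        -- The favourable term `-V * ∑ c, r c` is discarded, which leaves the numerator `B + V *
        -- BR`.
        have h2 : 0 ≤ V * ∑ c, r c := mul_nonneg hV.le (Finset.sum_nonneg fun c _ => hr0 c)
        simp only
        linarith
    _ = _ := by
        rw [integral_add (integrable_const _) ((integrable_timeAvg_sum hiR t).const_mul V)]
        simp

end ALG

/-- The size condition can be met with delay thresholds of order `1 / ε`. -/
lemma exists_sizeCondition_le (Node Flow : Type*) [Fintype Node] {μM : ℝ} (hμM : 1 ≤ μM) :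
    ∃ C : ℝ, ∀ ε : ℝ, 0 < ε → ε ≤ 1 → ∀ r : Flow → ℝ, (∀ c, 0 < r c) →
      ∃ (qM : ℝ) (ρ : Flow → ℝ), SizeCondition Node μM ε r qM ρ ∧ ∀ c, ρ c ≤ C / (ε * r c) := by
  set N : ℝ := (Fintype.card Node : ℝ) with hN_def
  have hN : 0 ≤ N := Nat.cast_nonneg _
  refine ⟨N * ((2 * N - 1 + μM ^ 2) / 2 + μM + 1) + 1, fun ε hε hε1 r hr => ?_⟩
  -- One more than the strict lower bound. Multiplying by `ε ≤ 1` bounds `ε * q` independently of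
  -- `ε`, and the final `+ 1` in the constant pays for the `+ 1` in the numerator of `ρ`.
  set q : ℝ := (2 * N - 1 + μM ^ 2) / (2 * ε) + μM + 1 with hq_def
  refine ⟨q, fun c => (N * q + 1) / r c, ⟨?_, fun c => ?_⟩, fun c => ?_⟩
  · exact lt_add_one _
  · exact div_lt_div_of_pos_right (lt_add_one _) (hr c)
  · rw [div_le_div_iff₀ (hr c) (mul_pos hε (hr c))]
    have h1 : ε * q ≤ (2 * N - 1 + μM ^ 2) / 2 + μM + 1 := by
      have e : ε * q = (2 * N - 1 + μM ^ 2) / 2 + ε * (μM + 1) := by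
        rw [hq_def]
        field_simp
        ring
      rw [e]
      nlinarith
    have h2 := mul_le_mul_of_nonneg_left h1 hN
    have h3 : (N * q + 1) * ε ≤ N * ((2 * N - 1 + μM ^ 2) / 2 + μM + 1) + 1 := by linarith
    calc (N * q + 1) * (ε * r c) = (N * q + 1) * ε * r c := by ring
      _ ≤ _ := mul_le_mul_of_nonneg_right h3 (hr c).le

end MultiHop

theorem theorem1 {Node Flow : Type*} [Fintype Node] [Fintype Flow]
    (net : MultiHop.Network Node Flow) (μM : ℝ) (hμM : 1 ≤ μM) :
    -- performance of ALG for all parameters that satisfy the size condition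
    (∀ (a r ρ : Flow → ℝ) (ε ε' qM V : ℝ),
      (∀ c, 0 ≤ a c) → 0 < ε → 0 < ε' → 0 < V →
      MultiHop.IsTightenedOptimum net μM a ε r → (∀ c, a c + ε' ≤ r c) →
      MultiHop.SizeCondition Node μM ε r qM ρ →
      ∀ (Ω : Type*) [MeasurableSpace Ω] (P : MeasureTheory.Measure Ω)
        [MeasureTheory.IsProbabilityMeasure P]
        (μ : ℕ → Ω → MultiHop.Rates Node Flow) (U : ℕ → Node → Flow → Ω → ℕ)
        (R Us X Z : ℕ → Flow → Ω → ℝ),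
      MultiHop.IsALG net μM qM V a ρ μ U R Us X Z →
      -- the expectations below are genuine
      (∀ t c, MeasureTheory.Integrable (R t c) P ∧ MeasureTheory.Integrable (Us t c) P ∧
        MeasureTheory.Integrable (X t c) P ∧ MeasureTheory.Integrable (Z t c) P) ∧
      -- throughput: virtual input rate, and rate of packets really admitted
      (((∑ c, r c) - MultiHop.constB Node μM qM a ρ / V : ℝ) : EReal)
        ≤ MultiHop.liminfAvg (fun τ => ∑ c, ∫ ω, R τ c ω ∂P) ∧
      (((∑ c, r c) - MultiHop.constB Node μM qM a ρ / V : ℝ) : EReal)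
        ≤ MultiHop.liminfAvg (fun τ => ∑ c, ∫ ω, (MultiHop.admitted (μ τ ω) c : ℝ) ∂P) ∧
      -- virtual queues
      MultiHop.limsupAvg (fun τ => ∑ c, ∫ ω, R τ c ω ∂P)
        ≤ (((Fintype.card Flow : ℝ) * μM : ℝ) : EReal) ∧
      (∀ BR ε₁ : ℝ,
        MultiHop.limsupAvg (fun τ => ∑ c, ∫ ω, R τ c ω ∂P) ≤ (BR : EReal) →
        0 < ε₁ →
        (∀ c, ε₁ ≤ ρ c * r c - (Fintype.card Node : ℝ) * qM) →
        ε₁ ≤ (ε * (qM - μM) - (2 * (Fintype.card Node : ℝ) - 1 + μM ^ 2) / 2) / qM →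
        MultiHop.limsupAvg (fun τ => ∑ c, ∫ ω, (Us τ c ω + X τ c ω + Z τ c ω) ∂P)
          ≤ (((MultiHop.constB Node μM qM a ρ + V * BR) / min ε₁ ε' : ℝ) : EReal)) ∧
      -- average end-to-end delay: mean backlog of a flow is at most `ρ c` times its admitted rate
      (∀ c, ∀ᵐ ω ∂P,
        MultiHop.limsupAvg (fun τ =>
          (∑ n, (U τ n c ω : ℝ)) - ρ c * (MultiHop.admitted (μ τ ω) c : ℝ)) ≤ 0)) ∧
    -- the delay thresholds can be chosen of order `1 / ε`
    (∃ C : ℝ, ∀ ε : ℝ, 0 < ε → ε ≤ 1 → ∀ r : Flow → ℝ, (∀ c, 0 < r c) →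
      ∃ (qM : ℝ) (ρ : Flow → ℝ), MultiHop.SizeCondition Node μM ε r qM ρ ∧
        ∀ c, ρ c ≤ C / (ε * r c)) := by
  refine ⟨?_, MultiHop.exists_sizeCondition_le Node Flow hμM⟩
  intro a r ρ ε ε' qM V ha hε hε' hV hopt har hs Ω _ P _ μ U R Us X Z h
  have hr : ∀ c, 0 < r c := fun c => by linarith [ha c, har c]
  obtain ⟨hq, hρ, -, -⟩ := hs.nonneg_slack hμM hε hr
  have hq0 : 0 < qM := by linarith
  obtain ⟨C, hC⟩ := h.exists_queue_le_sqrt hμM hV.le ha hε hr hopt.min_rate hopt.mem hs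
  have hR : ∀ {t : ℕ}, 0 < t → ∀ ω, _ := fun ht ω =>
    h.le_timeAvg_R hμM hV ha hε hr hopt.min_rate hopt.mem hs ht ω
  refine ⟨fun t c => ⟨h.integrable_R P t c, h.integrable_Us P t c, h.integrable_X hq0 hρ P t c,
    h.integrable_Z ha P t c⟩, ?_, ?_, h.limsupAvg_R_le (by linarith) P, ?_, fun c =>
    Filter.Eventually.of_forall fun ω => h.limsupAvg_backlog_sub_le hρ hC c ω⟩
  · refine MultiHop.le_liminfAvg_of_eventually (e := fun _ => 0) tendsto_const_nhds ?_
    filter_upwards [Filter.eventually_gt_atTop 0] with t ht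
    rw [sub_zero]
    exact MultiHop.le_timeAvg_sum_integral (h.integrable_R P) (hR ht)
  · refine MultiHop.le_liminfAvg_of_eventually
      (MultiHop.tendsto_const_mul_sqrt_div_atTop (Fintype.card Flow * C)) ?_
    filter_upwards [Filter.eventually_gt_atTop 0] with t ht
    refine MultiHop.le_timeAvg_sum_integral (h.integrable_admitted P) fun ω => ?_
    exact (sub_le_sub_right (hR ht ω) _).trans (h.timeAvg_R_sub_le hC t ω)
  · intro BR ε₁ hBR hε₁ hεX hεS
    exact h.limsupAvg_queues_le hμM hV hq ha hρ hε.le hopt.mem (fun c => (hr c).le)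
      (lt_min hε₁ hε') ((min_le_left _ _).trans hεS) (fun c => (min_le_left _ _).trans (hεX c))
      (fun c => (min_le_right _ _).trans (by linarith [har c])) P hBR
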